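/- Conventions. For a smooth map $\varphi:(M,g)\to(N,h)$ between Riemannian manifolds let $\tau(\varphi)=\mathrm{Trace}_g\nabla d\varphi$ be its tension field and $$\tau_2(\varphi)=\mathrm{Trace}_g\big(\nabla^{\varphi}\nabla^{\varphi}-\nabla^{\varphi}_{\nabla^{M}}\big)\tau(\varphi)-\mathrm{Trace}_g R^N(d\varphi,\tau(\varphi))\,d\varphi,\qquad R^N(X,Y)Z=[\nabla^N_X,\nabla^N_Y]Z-\nabla^N_{[X,Y]}Z,$$ its bitension field. The map $\varphi$ is harmonic if $\tau(\varphi)\equiv0$, biharmonic if $\tau_2(\varphi)\equiv 0$ (the Euler--Lagrange equation of the bienergy $\frac12\int|\tau(\varphi)|^2v_g$), and proper biharmonic if it is biharmonic and not harmonic. Let $S^n(r)\subset\mathbb R^{n+1}$ be the sphere of radius $r$ with the induced metric, and $S^n=S^n(1)$. Statement. Let $\Sigma\subset S^3$ be a sphere of radius $1/\sqrt2$: let $a\in\mathbb R^4$ be a unit vector, let $L:\mathbb R^3\to\mathbb R^4$ be a linear isometric embedding whose range is orthogonal to $a$, put $\varphi(u)=\frac1{\sqrt2}(Lu+a)$ for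 $u\in S^2$, and let $\Sigma=\varphi(S^2)$. Identify $S^2(1/\sqrt2)$ with $S^2$, endowed with the metric induced by $u\mapsto\frac{1}{\sqrt2}u\in\mathbb R^3$. Then: 1. $\varphi:S^2(1/\sqrt2)\to S^3$ is an injective isometric immersion with image $\Sigma=\{X\in S^3:\langle X,a\rangle=1/\sqrt2\}$. 2. $\varphi$ is proper biharmonic, and so is its restriction to every nonempty open subset of $S^2(1/\sqrt2)$. 3. In stereographic coordinates $\varphi$ is the map $$\left(\mathbb R^2,\ \frac{4(dx^2+dy^2)}{(2+x^2+y^2)^2}\right)\to\left(\mathbb R^3,\ \frac{4(dx^2+dy^2+dz^2)}{(1+x^2+y^2+z^2)^2}\right),\qquad (x,y)\mapsto(x,y,1).$$ Precisely, let $\sigma_n(x)=\frac{1}{1+|x|^2}(2x,|x|^2-1)$ be the inverse of the stereographic projection of $S^n$ from its north pole $N_n$. There is a linear isometry $T$ of $\mathbb R^4$ such that $P(x,y)=\sigma_2\big(\tfrac{1}{\sqrt2}(x,y)\big)$ is an injective isometric immersion of $\left(\mathbb R^2,\frac{4(dx^2+dy^2)}{(2+x^2+y^2)^2}\right)$ into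 $S^2(1/\sqrt2)$ with image the complement of $N_2$, $Q=T\circ\sigma_3$ is an injective isometric immersion of $\left(\mathbb R^3,\frac{4(dx^2+dy^2+dz^2)}{(1+x^2+y^2+z^2)^2}\right)$ into $S^3$ with image the complement of $TN_3$, and $\varphi(P(x,y))=Q(x,y,1)$ for all $(x,y)\in\mathbb R^2$. 4. The coordinate map $(x,y)\mapsto(x,y,1)$, with the two metrics in 3, is an isometric immersion, and its restriction to every nonempty open subset of $\mathbb R^2$ is proper biharmonic. -/

import Mathlib

open scoped Manifold ContDiff

noncomputable section

/-- Euclidean space `ℝⁿ`. -/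
abbrev Euc (n : ℕ) : Type := EuclideanSpace ℝ (Fin n)

/-- The unit sphere `Sⁿ` of `ℝⁿ⁺¹`, with Mathlib's smooth structure. -/
abbrev Sph (n : ℕ) : Type := Metric.sphere (0 : Euc (n + 1)) 1

/-- Smooth Riemannian metrics on an `m`-dimensional smooth manifold `M`. -/
abbrev Riem (m : ℕ) (M : Type*) [TopologicalSpace M] [ChartedSpace (Euc m) M]
    [IsManifold (𝓡 m) ∞ M] : Type _ :=
  Bundle.ContMDiffRiemannianMetric (𝓡 m) ∞ (Euc m) (fun p : M => TangentSpace (𝓡 m) p)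

/-! ### Tensor calculus in coordinates -/

/-- The partial derivative `∂ᵢ f`. -/
def pd {m : ℕ} (i : Fin m) (f : Euc m → ℝ) (x : Euc m) : ℝ :=
  fderiv ℝ f x (EuclideanSpace.single i 1)

/-- The Christoffel symbols
`Γᵏᵢⱼ = ½ ∑ₗ Gᵏˡ (∂ᵢ Gⱼₗ + ∂ⱼ Gᵢₗ - ∂ₗ Gᵢⱼ)` of the Levi-Civita connection of the metric with
coefficients `Gᵢⱼ`. -/
def christoffel {m : ℕ} (G : Euc m → Matrix (Fin m) (Fin m) ℝ) (k i j : Fin m) (x : Euc m) : ℝ :=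
  (1 / 2) * ∑ l, (G x)⁻¹ k l *
    (pd i (fun y => G y j l) x + pd j (fun y => G y i l) x - pd l (fun y => G y i j) x)

/-- The components of the curvature operator: the `d`-th component of `R(∂ₐ, ∂_b) ∂_c`, where
`R(X, Y) Z = ∇_X ∇_Y Z - ∇_Y ∇_X Z - ∇_[X,Y] Z`. -/
def curvatureCoeff {m : ℕ} (G : Euc m → Matrix (Fin m) (Fin m) ℝ) (d a b c : Fin m)
    (x : Euc m) : ℝ :=
  pd a (christoffel G d b c) x - pd b (christoffel G d a c) x +
    ∑ e, (christoffel G d a e x * christoffel G e b c x -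
      christoffel G d b e x * christoffel G e a c x)

/-- The covariant derivative `∇^ψ_{∂ᵢ} V` of a vector field `V` along `ψ : ℝᵐ → ℝⁿ`, for the
pullback of the Levi-Civita connection of the metric `H` on the target:
`(∇^ψ_{∂ᵢ} V)ᵃ = ∂ᵢ Vᵃ + ∑ Γᵃ_{bc}(ψ) ∂ᵢψᵇ Vᶜ`. -/
def covAlong {m n : ℕ} (H : Euc n → Matrix (Fin n) (Fin n) ℝ) (ψ : Euc m → Euc n)
    (i : Fin m) (V : Euc m → Fin n → ℝ) (x : Euc m) (a : Fin n) : ℝ :=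
  pd i (fun y => V y a) x +
    ∑ b, ∑ c, christoffel H a b c (ψ x) * pd i (fun y => ψ y b) x * V x c

/-- The tension field `τ(ψ) = Trace_G ∇dψ` in coordinates:
`τᵃ = ∑ Gⁱʲ ((∇^ψ_{∂ᵢ} ∂ⱼψ)ᵃ - ∑ₖ Γᵏᵢⱼ ∂ₖψᵃ)`. -/
def tensionCoord {m n : ℕ} (G : Euc m → Matrix (Fin m) (Fin m) ℝ)
    (H : Euc n → Matrix (Fin n) (Fin n) ℝ) (ψ : Euc m → Euc n) (x : Euc m) (a : Fin n) : ℝ :=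
  ∑ i, ∑ j, (G x)⁻¹ i j *
    (covAlong H ψ i (fun y b => pd j (fun z => ψ z b) y) x a -
      ∑ k, christoffel G k i j x * pd k (fun y => ψ y a) x)

/-- The bitension field
`τ₂(ψ) = Trace_G (∇^ψ ∇^ψ - ∇^ψ_{∇^M}) τ(ψ) - Trace_G R^N(dψ, τ(ψ)) dψ` in coordinates. -/
def bitensionCoord {m n : ℕ} (G : Euc m → Matrix (Fin m) (Fin m) ℝ)
    (H : Euc n → Matrix (Fin n) (Fin n) ℝ) (ψ : Euc m → Euc n) (x : Euc m) (a : Fin n) : ℝ :=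
  ∑ i, ∑ j, (G x)⁻¹ i j *
      (covAlong H ψ i (covAlong H ψ j (tensionCoord G H ψ)) x a -
        ∑ k, christoffel G k i j x * covAlong H ψ k (tensionCoord G H ψ) x a) -
    ∑ i, ∑ j, (G x)⁻¹ i j *
      ∑ b, ∑ c, ∑ d, curvatureCoeff H a b c d (ψ x) *
        pd i (fun y => ψ y b) x * tensionCoord G H ψ x c * pd j (fun y => ψ y d) x

/-! ### Harmonic and biharmonic maps between Riemannian manifolds -/

section Maps

variable {m n : ℕ} {M N : Type*}
  [TopologicalSpace M] [ChartedSpace (Euc m) M] [IsManifold (𝓡 m) ∞ M]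
  [TopologicalSpace N] [ChartedSpace (Euc n) N] [IsManifold (𝓡 n) ∞ N]

/-- The coefficients `g(∂ᵢ, ∂ⱼ)` of a Riemannian metric in the chart `e`. -/
def metricCoeff (g : Riem m M) (e : OpenPartialHomeomorph M (Euc m)) (x : Euc m) :
    Matrix (Fin m) (Fin m) ℝ :=
  Matrix.of fun i j => g.inner (e.symm x)
    (mfderiv (𝓡 m) (𝓡 m) e.symm x (EuclideanSpace.single i (1 : ℝ) : Euc m))
    (mfderiv (𝓡 m) (𝓡 m) e.symm x (EuclideanSpace.single j (1 : ℝ) : Euc m))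

/-- The map `φ` written in the preferred charts at `p` and at `φ p`. -/
def localRep (φ : M → N) (p : M) : Euc m → Euc n :=
  fun x => chartAt (Euc n) (φ p) (φ ((chartAt (Euc m) p).symm x))

/-- The components, in the preferred chart at `φ p`, of the tension field
`τ(φ) = Trace_g ∇dφ` at `p`. -/
def tension (g : Riem m M) (h : Riem n N) (φ : M → N) (p : M) : Fin n → ℝ :=
  tensionCoord (metricCoeff g (chartAt (Euc m) p)) (metricCoeff h (chartAt (Euc n) (φ p)))
    (localRep φ p) (chartAt (Euc m) p p)

/-- The components, in the preferred chart at `φ p`, of the bitension field `τ₂(φ)` at `p`. -/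
def bitension (g : Riem m M) (h : Riem n N) (φ : M → N) (p : M) : Fin n → ℝ :=
  bitensionCoord (metricCoeff g (chartAt (Euc m) p)) (metricCoeff h (chartAt (Euc n) (φ p)))
    (localRep φ p) (chartAt (Euc m) p p)

/-- `φ : (M, g) → (N, h)` is smooth and harmonic on the open set `U`. -/
def IsHarmonicOn (g : Riem m M) (h : Riem n N) (φ : M → N) (U : Set M) : Prop :=
  ContMDiffOn (𝓡 m) (𝓡 n) ∞ φ U ∧ ∀ p ∈ U, tension g h φ p = 0

/-- `φ : (M, g) → (N, h)` is smooth and biharmonic on the open set `U`. -/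
def IsBiharmonicOn (g : Riem m M) (h : Riem n N) (φ : M → N) (U : Set M) : Prop :=
  ContMDiffOn (𝓡 m) (𝓡 n) ∞ φ U ∧ ∀ p ∈ U, bitension g h φ p = 0

/-- Proper biharmonic: biharmonic but not harmonic. -/
def IsProperBiharmonicOn (g : Riem m M) (h : Riem n N) (φ : M → N) (U : Set M) : Prop :=
  IsBiharmonicOn g h φ U ∧ ¬ IsHarmonicOn g h φ U

/-- `φ : (M, g) → (N, h)` is an isometric immersion: it is smooth and `φ^* h = g`. -/
def IsIsometricImmersion (g : Riem m M) (h : Riem n N) (φ : M → N) : Prop :=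
  ContMDiff (𝓡 m) (𝓡 n) ∞ φ ∧
    ∀ (p : M) (u v : TangentSpace (𝓡 m) p),
      h.inner (φ p) (mfderiv (𝓡 m) (𝓡 n) φ p u) (mfderiv (𝓡 m) (𝓡 n) φ p v) = g.inner p u v

end Maps

/-! ### The metrics -/

theorem isVonNBounded_of_injective {m k : ℕ} (A : Euc m →L[ℝ] Euc k)
    (hA : Function.Injective A) :
    Bornology.IsVonNBounded ℝ {v : Euc m | inner ℝ (A v) (A v) < 1} := by
  obtain ⟨K, -, hK⟩ := (A : Euc m →ₗ[ℝ] Euc k).exists_antilipschitzWith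
    (LinearMap.ker_eq_bot.2 hA)
  refine (NormedSpace.isVonNBounded_closedBall ℝ (Euc m) K).subset fun v hv => ?_
  have h1 : ‖A v‖ ^ 2 < 1 := by
    rw [← real_inner_self_eq_norm_sq]
    exact hv
  have h2 : ‖A v‖ ≤ 1 := by nlinarith [norm_nonneg (A v)]
  have h3 := hK.le_mul_dist v 0
  rw [mem_closedBall_zero_iff]
  simp only [dist_zero_right, ContinuousLinearMap.coe_coe, map_zero] at h3
  exact h3.trans (mul_le_of_le_one_right K.2 h2)

section Metrics

variable {m : ℕ} {M : Type*} [TopologicalSpace M] [ChartedSpace (Euc m) M]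
  [IsManifold (𝓡 m) ∞ M]

/-- The bilinear form `(u, v) ↦ ⟪df(u), df(v)⟫` on the tangent space at `p`. -/
def pullbackForm {k : ℕ} (f : M → Euc k) (p : M) :
    TangentSpace (𝓡 m) p →L[ℝ] TangentSpace (𝓡 m) p →L[ℝ] ℝ :=
  ((mvfderiv (𝓡 m) f p).precomp ℝ).comp
    ((innerSL ℝ : Euc k →L[ℝ] Euc k →L[ℝ] ℝ).comp (mvfderiv (𝓡 m) f p))

/-- The metric induced on `M` by an immersion `f` into a Euclidean space. -/
def inducedMetric {k : ℕ} (f : M → Euc k) (hf : ContMDiff (𝓡 m) 𝓘(ℝ, Euc k) ∞ f)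
    (hinj : ∀ p, Function.Injective (mvfderiv (𝓡 m) f p)) : Riem m M where
  inner := pullbackForm f
  symm p v w := real_inner_comm (F := Euc k) _ _
  pos p v hv := by
    change 0 < inner ℝ (mvfderiv (𝓡 m) f p v) (mvfderiv (𝓡 m) f p v)
    exact real_inner_self_pos.2 fun h => hv (hinj p (h.trans (map_zero _).symm))
  isVonNBounded p := isVonNBounded_of_injective (mvfderiv (𝓡 m) f p) (hinj p)
  contMDiff := by
    intro p
    rw [contMDiffAt_hom_bundle]
    refine ⟨contMDiffAt_id, ?_⟩
    have h1 := (hf p).mfderiv_const (m := ∞) le_rfl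
    let B : (Euc m →L[ℝ] Euc k) → (Euc m →L[ℝ] Euc m →L[ℝ] ℝ) := fun D =>
      (innerSL ℝ : Euc k →L[ℝ] Euc k →L[ℝ] ℝ).bilinearComp D D
    have hB : ContDiff ℝ ∞ B := by
      have : B = fun D => ((ContinuousLinearMap.compL ℝ (Euc m) (Euc k) ℝ).flip D).comp
          ((innerSL ℝ : Euc k →L[ℝ] Euc k →L[ℝ] ℝ).comp D) := by
        ext D v w
        rfl
      rw [this]
      fun_prop
    have h2 := hB.contMDiff.contMDiffAt.comp p h1
    refine h2.congr_of_eventuallyEq ?_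
    filter_upwards [(chartAt (Euc m) p).open_source.mem_nhds (mem_chart_source _ p)] with x hx
    ext v w
    simp [B, ContinuousLinearMap.inCoordinates, inTangentCoordinates, mvfderiv, pullbackForm]
    rw [Bundle.Trivialization.linearMapAt_apply, if_pos]
    · simp [hom_trivializationAt_apply, ContinuousLinearMap.inCoordinates]
      rfl
    · simp
      exact hx

/-- The conformal change `w g` of the metric `g` by a smooth positive function `w`. -/
def conformalChange (w : M → ℝ) (hw : ContMDiff (𝓡 m) 𝓘(ℝ) ∞ w) (hpos : ∀ x, 0 < w x)
    (g : Riem m M) : Riem m M where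
  inner x := w x • g.inner x
  symm x u v := congrArg (w x * ·) (g.symm x u v)
  pos x v hv := mul_pos (hpos x) (g.pos x v hv)
  isVonNBounded x := by
    have := (g.isVonNBounded x).image
      (((Real.sqrt (w x))⁻¹) • ContinuousLinearMap.id ℝ (TangentSpace (𝓡 m) x))
    refine this.subset fun v hv => (Set.mem_image _ _ _).2 ⟨Real.sqrt (w x) • v, ?_, ?_⟩
    · have h : g.inner x (Real.sqrt (w x) • v) (Real.sqrt (w x) • v) = w x * g.inner x v v := by
        simp only [map_smul, FunLike.coe_smul, Pi.smul_apply, smul_eq_mul]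
        rw [← mul_assoc, Real.mul_self_sqrt (hpos x).le]
      exact h.trans_lt hv
    · simp [smul_smul, (Real.sqrt_pos.2 (hpos x)).ne']
  contMDiff := hw.smul_section g.contMDiff

end Metrics

/-- The flat metric `dx₁² + ⋯ + dxₙ²` on `ℝⁿ`. -/
def flatMetric (n : ℕ) : Riem n (Euc n) where
  inner := (riemannianMetricVectorSpace (Euc n)).inner
  symm := (riemannianMetricVectorSpace (Euc n)).symm
  pos := (riemannianMetricVectorSpace (Euc n)).pos
  isVonNBounded := (riemannianMetricVectorSpace (Euc n)).isVonNBounded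
  contMDiff := (riemannianMetricVectorSpace (Euc n)).contMDiff.of_le le_top

/-- The metric `4 (dx₁² + ⋯ + dxₙ²) / (c + |x|²)²` on `ℝⁿ`. -/
def stereoMetric (n : ℕ) (c : ℝ) (hc : 0 < c) : Riem n (Euc n) :=
  conformalChange (fun x => 4 / (c + ‖x‖ ^ 2) ^ 2)
    (ContDiff.contMDiff (contDiff_const.div ((contDiff_const.add (contDiff_norm_sq ℝ)).pow 2)
      fun x => by positivity))
    (fun x => by positivity) (flatMetric n)

/-- The round metric of the sphere `Sⁿ(r)` of radius `r`, carried to the unit sphere by `u ↦ r u`: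
the metric induced by `u ↦ r u ∈ ℝⁿ⁺¹`. Thus `(Sph n, sphereMetric n r)` is the Riemannian
manifold `Sⁿ(r)`. -/
def sphereMetric (n : ℕ) (r : ℝ) (hr : 0 < r) : Riem n (Sph n) :=
  inducedMetric (fun u : Sph n => r • (u : Euc (n + 1)))
    (by
      have : Fact (Module.finrank ℝ (Euc (n + 1)) = n + 1) := ⟨finrank_euclideanSpace_fin⟩
      exact (contDiff_const_smul (𝕜 := ℝ) (F := Euc (n + 1)) r).contMDiff.comp
        (contMDiff_coe_sphere (E := Euc (n + 1)) (n := n)))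
    (fun p => by
      have : Fact (Module.finrank ℝ (Euc (n + 1)) = n + 1) := ⟨finrank_euclideanSpace_fin⟩
      have h := injective_mvfderiv_subtypeVal_sphere (E := Euc (n + 1)) (n := n) p
      have hd : MDifferentiableAt (𝓡 n) 𝓘(ℝ, Euc (n + 1)) ((↑) : Sph n → Euc (n + 1)) p :=
        (contMDiff_coe_sphere (m := 1) p).mdifferentiableAt one_ne_zero
      have e := mvfderiv_fun_smul (a := fun _ : Sph n => r) mdifferentiableAt_const hd
      intro u v huv
      apply h
      have e' : ∀ w, mvfderiv (𝓡 n) (fun u : Sph n => r • (u : Euc (n + 1))) p w =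
          r • mvfderiv (𝓡 n) ((↑) : Sph n → Euc (n + 1)) p w := fun w => by
        have := congrArg (fun A => A w) e
        simpa [mvfderiv_const] using this
      rw [e', e'] at huv
      exact smul_right_injective _ hr.ne' huv)

/-! ### Spheres and stereographic coordinates -/

theorem inv_sqrt_two_pos : 0 < 1 / √(2 : ℝ) := by positivity

/-- Given a linear isometry `L : ℝ³ → ℝ⁴` and a unit vector `a` orthogonal to its range, the map
`u ↦ (L u + a) / √2` from `S²` to `S³`. Its image is the sphere of radius `1/√2` cut out of `S³`
by the hyperplane `⟪X, a⟫ = 1/√2`. -/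
def smallSphere (L : Euc 3 →ₗᵢ[ℝ] Euc 4) (a : Euc 4) (ha : ‖a‖ = 1)
    (hLa : ∀ v, inner ℝ (L v) a = 0) (u : Sph 2) : Sph 3 :=
  ⟨(1 / √(2 : ℝ)) • (L (u : Euc 3) + a), by
    have h : ‖L (u : Euc 3) + a‖ ^ 2 = 2 := by
      rw [norm_add_sq_real, hLa, L.norm_map, ha, norm_eq_of_mem_sphere u]
      norm_num
    have h' : ‖L (u : Euc 3) + a‖ = √2 := by
      rw [← h, Real.sqrt_sq (norm_nonneg _)]
    rw [mem_sphere_zero_iff_norm, norm_smul, h', Real.norm_of_nonneg inv_sqrt_two_pos.le]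
    field_simp⟩

/-- The north pole `(0, …, 0, 1)` of `Sⁿ`. -/
def northPole (n : ℕ) : Sph n :=
  ⟨EuclideanSpace.single (Fin.last n) 1, by simp⟩

/-- The inverse `x ↦ (2x, |x|² - 1) / (1 + |x|²)` of the stereographic projection of `Sⁿ` from the
north pole onto the equatorial hyperplane. -/
def stereoInv (n : ℕ) (x : Euc n) : Sph n :=
  ⟨WithLp.toLp 2 (Fin.snoc (α := fun _ => ℝ) (fun i => 2 * x i / (1 + ‖x‖ ^ 2))
      ((‖x‖ ^ 2 - 1) / (1 + ‖x‖ ^ 2))), by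
    rw [mem_sphere_zero_iff_norm, ← sq_eq_sq₀ (norm_nonneg _) zero_le_one,
      EuclideanSpace.real_norm_sq_eq, Fin.sum_univ_castSucc]
    have h : 1 + ‖x‖ ^ 2 ≠ 0 := by positivity
    simp only [Fin.snoc_castSucc, Fin.snoc_last, div_pow, mul_pow, ← Finset.sum_div,
      ← Finset.mul_sum, ← EuclideanSpace.real_norm_sq_eq]
    field_simp
    ring⟩

/-- The isometry of `Sⁿ` given by a linear isometry of `ℝⁿ⁺¹`. -/
def rotateSphere {n : ℕ} (T : Euc (n + 1) ≃ₗᵢ[ℝ] Euc (n + 1)) (u : Sph n) : Sph n :=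
  ⟨T (u : Euc (n + 1)), by simp [T.norm_map, norm_eq_of_mem_sphere u]⟩

/-- The map `(x, y) ↦ (x, y, 1)`. -/
def planeMap (x : Euc 2) : Euc 3 := !₂[x 0, x 1, 1]

end

/-!
For a map into a round sphere of curvature `κ`, viewed in the ambient Euclidean space as a
vector-valued map `f`, the Gauss formula turns the covariant derivative along the map into
`∂ᵢW + κ⟪∂ᵢf, W⟫ f`, and the Gauss equation gives the curvature. The tension and bitension fields
can therefore be computed with derivatives of vector-valued functions.

A sphere of radius `r` placed as `A E + b` in the sphere of radius `ρ`, with `A` a linear isometry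
and `b` orthogonal to its range, is totally umbilical: its second fundamental form is `Gᵢⱼ η`, where
the normal field `η` satisfies `∂ᵢη = -ℓ ∂ᵢf` with `ℓ = r⁻² - ρ⁻²`. Hence in dimension `m` one has
`τ = m η` and `τ₂ = m² (ρ⁻² - ℓ) η = m² (2ρ⁻² - r⁻²) η`, which vanishes for `ρ² = 2r²` although `η`
has no zero when `b ≠ 0`.

Inverse stereographic projection is the restriction to the equatorial hyperplane of the inversion
with centre the north pole and radius `√2`. The plane `z = 1` corresponds under it to a sphere of
radius `1/√2`, and a rotation by `π/4` brings this sphere to the given one.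
-/

noncomputable section

section PartialDerivatives

variable {m n : ℕ} {V W : Type*} [NormedAddCommGroup V] [NormedAddCommGroup W]
  {i : Fin m} {s : Set (Euc m)} {x : Euc m}

section NormedSpace

variable [NormedSpace ℝ V] [NormedSpace ℝ W] {f g : Euc m → V}

/-- The partial derivative `∂ᵢ f` of a vector-valued map. For `V = ℝ` this is `pd i f` by
definition. -/
def partialDeriv (i : Fin m) (f : Euc m → V) (x : Euc m) : V :=
  fderiv ℝ f x (EuclideanSpace.single i 1)

/-- The tangent vector `∑ vᵃ ∂ₐF` at the point `y` of a parametrization `F`, as a function of its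
components `vᵃ`. -/
def pushforward (F : Euc n → V) (y : Euc n) : (Fin n → ℝ) →ₗ[ℝ] V :=
  Fintype.linearCombination ℝ fun a => partialDeriv a F y

theorem pushforward_apply (F : Euc n → V) (y : Euc n) (v : Fin n → ℝ) :
    pushforward F y v = ∑ a, v a • partialDeriv a F y :=
  rfl

theorem fderiv_apply_eq_pushforward (f : Euc m → V) (x v : Euc m) :
    fderiv ℝ f x v = pushforward f x v := by
  conv_lhs => rw [← (EuclideanSpace.basisFun (Fin m) ℝ).sum_repr v]
  simp only [map_sum, map_smul, EuclideanSpace.basisFun_repr, EuclideanSpace.basisFun_apply,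
    pushforward_apply, partialDeriv]

theorem partialDeriv_clm_apply (A : V →L[ℝ] W) (hf : DifferentiableAt ℝ f x) :
    partialDeriv i (fun y => A (f y)) x = A (partialDeriv i f x) := by
  have h : HasFDerivAt (fun y => A (f y)) (A.comp (fderiv ℝ f x)) x :=
    A.hasFDerivAt.comp x hf.hasFDerivAt
  simp [partialDeriv, h.fderiv]

theorem partialDeriv_comp {F : Euc n → V} {ψ : Euc m → Euc n}
    (hF : DifferentiableAt ℝ F (ψ x)) (hψ : DifferentiableAt ℝ ψ x) :
    partialDeriv i (F ∘ ψ) x = pushforward F (ψ x) fun a => pd i (fun y => ψ y a) x := by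
  rw [partialDeriv, fderiv_comp x hF hψ, ContinuousLinearMap.comp_apply,
    fderiv_apply_eq_pushforward]
  congr 1 with a
  exact (partialDeriv_clm_apply (EuclideanSpace.proj a) hψ).symm

theorem partialDeriv_congr (hs : IsOpen s) (h : Set.EqOn f g s) :
    Set.EqOn (partialDeriv i f) (partialDeriv i g) s := fun _ hx => by
  rw [partialDeriv, (h.eventuallyEq_of_mem (hs.mem_nhds hx)).fderiv_eq, partialDeriv]

theorem contDiffOn_partialDeriv (hs : IsOpen s) (hf : ContDiffOn ℝ ∞ f s) :
    ContDiffOn ℝ ∞ (partialDeriv i f) s :=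
  (hf.fderiv_of_isOpen hs le_rfl).clm_apply contDiffOn_const

theorem partialDeriv_partialDeriv_comm (hf : ContDiffAt ℝ 2 f x) (i j : Fin m) :
    partialDeriv i (partialDeriv j f) x = partialDeriv j (partialDeriv i f) x := by
  have hdiff : DifferentiableAt ℝ (fderiv ℝ f) x :=
    (hf.fderiv_right (m := 1) le_rfl).differentiableAt one_ne_zero
  have hsnd (k l : Fin m) : partialDeriv k (partialDeriv l f) x =
      fderiv ℝ (fderiv ℝ f) x (EuclideanSpace.single k 1) (EuclideanSpace.single l 1) := by
    change fderiv ℝ (fun y => fderiv ℝ f y (EuclideanSpace.single l 1)) x _ = _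
    rw [fderiv_clm_apply hdiff (differentiableAt_const _)]
    simp
  rw [hsnd, hsnd]
  exact hf.isSymmSndFDerivAt (by simp) _ _

theorem partialDeriv_const (c : V) : partialDeriv i (fun _ => c) x = 0 := by
  simp [partialDeriv]

theorem partialDeriv_add_const (f : Euc m → V) (c : V) :
    partialDeriv i (fun y => f y + c) x = partialDeriv i f x := by
  rw [partialDeriv, fderiv_add_const, partialDeriv]

theorem partialDeriv_add (hf : DifferentiableAt ℝ f x) (hg : DifferentiableAt ℝ g x) :
    partialDeriv i (fun y => f y + g y) x = partialDeriv i f x + partialDeriv i g x := by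
  simp [partialDeriv, fderiv_fun_add hf hg]

theorem partialDeriv_sum {ι : Type*} {t : Finset ι} {f : ι → Euc m → V}
    (hf : ∀ k ∈ t, DifferentiableAt ℝ (f k) x) :
    partialDeriv i (fun y => ∑ k ∈ t, f k y) x = ∑ k ∈ t, partialDeriv i (f k) x := by
  simp only [partialDeriv, fderiv_fun_sum hf, FunLike.coe_sum, Finset.sum_apply]

theorem partialDeriv_smul {c : Euc m → ℝ} (hc : DifferentiableAt ℝ c x)
    (hf : DifferentiableAt ℝ f x) :
    partialDeriv i (fun y => c y • f y) x = c x • partialDeriv i f x + pd i c x • f x := by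
  simp [partialDeriv, pd, fderiv_fun_smul hc hf]

end NormedSpace

theorem pd_inner [InnerProductSpace ℝ V] {f g : Euc m → V} (hf : DifferentiableAt ℝ f x)
    (hg : DifferentiableAt ℝ g x) :
    pd i (fun y => inner ℝ (f y) (g y)) x =
      inner ℝ (f x) (partialDeriv i g x) + inner ℝ (partialDeriv i f x) (g x) :=
  fderiv_inner_apply ℝ hf hg _

end PartialDerivatives

section MatrixInverse

variable {E ι : Type*} [NormedAddCommGroup E] [NormedSpace ℝ E] [Fintype ι] [DecidableEq ι]
  {A : E → Matrix ι ι ℝ} {k : ℕ∞ω} {s : Set E}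

theorem contDiffOn_det (hA : ∀ i j, ContDiffOn ℝ k (fun x => A x i j) s) :
    ContDiffOn ℝ k (fun x => (A x).det) s := by
  simp only [Matrix.det_apply, Units.smul_def, zsmul_eq_mul]
  exact .sum fun σ _ => contDiffOn_const.mul (contDiffOn_prod fun i _ => hA (σ i) i)

theorem contDiffOn_inv_apply (hA : ∀ i j, ContDiffOn ℝ k (fun x => A x i j) s)
    (hdet : ∀ x ∈ s, (A x).det ≠ 0) (i j : ι) : ContDiffOn ℝ k (fun x => (A x)⁻¹ i j) s := by
  simp only [Matrix.inv_def, Ring.inverse_eq_inv', Matrix.smul_apply, smul_eq_mul,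
    Matrix.adjugate_apply]
  refine ((contDiffOn_det hA).inv hdet).mul (contDiffOn_det fun a b => ?_)
  rcases eq_or_ne a j with rfl | h
  · simpa using contDiffOn_const
  · simpa [Matrix.updateRow_ne h] using hA a b

end MatrixInverse

section IsometricParam

variable {m : ℕ} {V : Type*} [NormedAddCommGroup V] [InnerProductSpace ℝ V]

/-- `F` is, on the open set `s`, a smooth regular parametrization of a submanifold of `V` whose
first fundamental form has the coefficients `Gᵢⱼ`. -/
structure IsIsometricParam (G : Euc m → Matrix (Fin m) (Fin m) ℝ) (F : Euc m → V)
    (s : Set (Euc m)) : Prop where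
  isOpen : IsOpen s
  contDiffOn : ContDiffOn ℝ ∞ F s
  linearIndependent : ∀ x ∈ s, LinearIndependent ℝ fun i => partialDeriv i F x
  coeff_eq : ∀ x ∈ s, ∀ i j, G x i j = inner ℝ (partialDeriv i F x) (partialDeriv j F x)

/-- The Hessian `∂ᵢ∂ⱼf - ∑ Γᵏᵢⱼ ∂ₖf` of a vector-valued map with respect to the metric `G`. When `f`
parametrizes a submanifold isometrically, this is its second fundamental form. -/
def hessian (G : Euc m → Matrix (Fin m) (Fin m) ℝ) (f : Euc m → V) (i j : Fin m) (x : Euc m) : V :=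
  partialDeriv i (partialDeriv j f) x - ∑ k, christoffel G k i j x • partialDeriv k f x

namespace IsIsometricParam

variable {G : Euc m → Matrix (Fin m) (Fin m) ℝ} {F : Euc m → V} {s : Set (Euc m)} {x : Euc m}

theorem contDiffOn_partialDeriv (hF : IsIsometricParam G F s) (i : Fin m) :
    ContDiffOn ℝ ∞ (partialDeriv i F) s :=
  _root_.contDiffOn_partialDeriv hF.isOpen hF.contDiffOn

theorem differentiableAt (hF : IsIsometricParam G F s) (hx : x ∈ s) : DifferentiableAt ℝ F x :=
  (hF.contDiffOn.contDiffAt (hF.isOpen.mem_nhds hx)).differentiableAt (by simp)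

theorem differentiableAt_partialDeriv (hF : IsIsometricParam G F s) (hx : x ∈ s) (i : Fin m) :
    DifferentiableAt ℝ (partialDeriv i F) x :=
  ((hF.contDiffOn_partialDeriv i).contDiffAt (hF.isOpen.mem_nhds hx)).differentiableAt (by simp)

theorem partialDeriv_partialDeriv_comm (hF : IsIsometricParam G F s) (hx : x ∈ s) (i j : Fin m) :
    partialDeriv i (partialDeriv j F) x = partialDeriv j (partialDeriv i F) x :=
  _root_.partialDeriv_partialDeriv_comm
    (contDiffAt_infty.1 (hF.contDiffOn.contDiffAt (hF.isOpen.mem_nhds hx)) 2) i j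

theorem isSymm (hF : IsIsometricParam G F s) (hx : x ∈ s) : (G x).IsSymm :=
  Matrix.IsSymm.ext fun i j => by rw [hF.coeff_eq x hx, hF.coeff_eq x hx, real_inner_comm]

theorem det_ne_zero (hF : IsIsometricParam G F s) (hx : x ∈ s) : (G x).det ≠ 0 := by
  have hG : G x = Matrix.gram ℝ fun i => partialDeriv i F x := by
    ext i j
    exact hF.coeff_eq x hx i j
  rw [hG]
  exact Matrix.det_gram_ne_zero_iff_linearIndependent.2 (hF.linearIndependent x hx)

theorem sum_inv_mul_coeff (hF : IsIsometricParam G F s) (hx : x ∈ s) :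
    ∑ i, ∑ j, (G x)⁻¹ i j * G x i j = m := by
  calc ∑ i, ∑ j, (G x)⁻¹ i j * G x i j = ((G x)⁻¹ * G x).trace := by
        simp only [Matrix.trace, Matrix.diag_apply, Matrix.mul_apply]
        simp_rw [fun i j => (hF.isSymm hx).apply i j]
    _ = m := by
        rw [Matrix.nonsing_inv_mul _ (isUnit_iff_ne_zero.2 (hF.det_ne_zero hx)), Matrix.trace_one,
          Fintype.card_fin]

theorem contDiffOn_coeff (hF : IsIsometricParam G F s) (i j : Fin m) :
    ContDiffOn ℝ ∞ (fun x => G x i j) s :=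
  ((hF.contDiffOn_partialDeriv i).inner ℝ (hF.contDiffOn_partialDeriv j)).congr
    fun x hx => hF.coeff_eq x hx i j

theorem contDiffOn_inv_coeff (hF : IsIsometricParam G F s) (i j : Fin m) :
    ContDiffOn ℝ ∞ (fun x => (G x)⁻¹ i j) s :=
  contDiffOn_inv_apply hF.contDiffOn_coeff (fun _ => hF.det_ne_zero) i j

theorem contDiffOn_christoffel (hF : IsIsometricParam G F s) (k i j : Fin m) :
    ContDiffOn ℝ ∞ (christoffel G k i j) s := by
  have hpd (l p q : Fin m) : ContDiffOn ℝ ∞ (pd l fun y => G y p q) s :=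
    _root_.contDiffOn_partialDeriv hF.isOpen (hF.contDiffOn_coeff p q)
  exact contDiffOn_const.mul <| .sum fun l _ =>
    (hF.contDiffOn_inv_coeff k l).mul (((hpd i j l).add (hpd j i l)).sub (hpd l i j))

theorem pd_coeff (hF : IsIsometricParam G F s) (hx : x ∈ s) (k i j : Fin m) :
    pd k (fun y => G y i j) x =
      inner ℝ (partialDeriv i F x) (partialDeriv k (partialDeriv j F) x) +
        inner ℝ (partialDeriv k (partialDeriv i F) x) (partialDeriv j F x) := by
  rw [← pd_inner (hF.differentiableAt_partialDeriv hx i) (hF.differentiableAt_partialDeriv hx j)]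
  exact partialDeriv_congr hF.isOpen (fun y hy => hF.coeff_eq y hy i j) hx

theorem sum_christoffel_mul_coeff (hF : IsIsometricParam G F s) (hx : x ∈ s) (i j l : Fin m) :
    ∑ k, christoffel G k i j x * G x k l =
      inner ℝ (partialDeriv i (partialDeriv j F) x) (partialDeriv l F x) := by
  set γ : Fin m → ℝ := fun p =>
    pd i (fun y => G y j p) x + pd j (fun y => G y i p) x - pd p (fun y => G y i j) x with hγ
  have hΓ : (fun k => christoffel G k i j x) = (1 / 2 : ℝ) • (G x)⁻¹.mulVec γ := rfl
  have hlower : (G x).mulVec (fun k => christoffel G k i j x) = (1 / 2 : ℝ) • γ := by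
    rw [hΓ, Matrix.mulVec_smul, Matrix.mulVec_mulVec,
      Matrix.mul_nonsing_inv _ (isUnit_iff_ne_zero.2 (hF.det_ne_zero hx)), Matrix.one_mulVec]
  calc ∑ k, christoffel G k i j x * G x k l
      = (G x).mulVec (fun k => christoffel G k i j x) l :=
        Finset.sum_congr rfl fun k _ => by rw [mul_comm, (hF.isSymm hx).apply]
    _ = 1 / 2 * γ l := congrFun hlower l
    _ = inner ℝ (partialDeriv i (partialDeriv j F) x) (partialDeriv l F x) := by
        simp only [hγ, hF.pd_coeff hx, hF.partialDeriv_partialDeriv_comm hx j i,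
          hF.partialDeriv_partialDeriv_comm hx l i, hF.partialDeriv_partialDeriv_comm hx l j]
        simp only [real_inner_comm (partialDeriv j F x), real_inner_comm (partialDeriv l F x)]
        ring

theorem inner_hessian_partialDeriv (hF : IsIsometricParam G F s) (hx : x ∈ s) (i j l : Fin m) :
    inner ℝ (hessian G F i j x) (partialDeriv l F x) = 0 := by
  simp only [hessian, inner_sub_left, sum_inner, real_inner_smul_left, ← hF.coeff_eq x hx,
    hF.sum_christoffel_mul_coeff hx, sub_self]

end IsIsometricParam

end IsometricParam

section Orthogonal

variable {E : Type*} [NormedAddCommGroup E] [InnerProductSpace ℝ E] [FiniteDimensional ℝ E]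

theorem eq_orthogonal_span_singleton {K : Submodule ℝ E} {a : E} (ha : a ≠ 0)
    (hK : ∀ v ∈ K, inner ℝ v a = 0) (hdim : Module.finrank ℝ K + 1 = Module.finrank ℝ E) :
    K = (ℝ ∙ a)ᗮ := by
  refine Submodule.eq_of_le_of_finrank_eq
    (fun v hv => Submodule.mem_orthogonal_singleton_iff_inner_left.2 (hK v hv)) ?_
  have := Submodule.finrank_add_finrank_orthogonal (ℝ ∙ a)
  rw [finrank_span_singleton ha] at this
  omega

theorem eq_zero_of_inner_linearIndependent_eq_zero {n : ℕ} {v : Fin n → E} {a u : E}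
    (hv : LinearIndependent ℝ v) (hdim : Module.finrank ℝ E = n + 1) (ha : a ≠ 0)
    (hva : ∀ i, inner ℝ (v i) a = 0) (hu : ∀ i, inner ℝ u (v i) = 0) (hua : inner ℝ u a = 0) :
    u = 0 := by
  have hspan : Submodule.span ℝ (Set.range v) = (ℝ ∙ a)ᗮ := by
    refine eq_orthogonal_span_singleton ha (fun w hw => ?_) ?_
    · refine (Submodule.mem_orthogonal_singleton_iff_inner_left (𝕜 := ℝ)).1
        (Submodule.span_le.2 ?_ hw)
      rintro _ ⟨i, rfl⟩
      exact Submodule.mem_orthogonal_singleton_iff_inner_left.2 (hva i)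
    · rw [finrank_span_eq_card hv, Fintype.card_fin, hdim]
  have hu_mem : u ∈ Submodule.span ℝ (Set.range v) :=
    hspan ▸ Submodule.mem_orthogonal_singleton_iff_inner_left.2 hua
  rw [← inner_self_eq_zero (𝕜 := ℝ)]
  refine Submodule.span_induction (p := fun w _ => inner ℝ u w = 0) ?_ (inner_zero_right u)
    (fun w z _ _ hw hz => by rw [inner_add_right, hw, hz, add_zero])
    (fun c w _ hw => by rw [real_inner_smul_right, hw, mul_zero]) hu_mem
  rintro _ ⟨i, rfl⟩
  exact hu i

end Orthogonal

section SphericalParam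

variable {n : ℕ}

/-- `F` is a smooth regular parametrization, by the open set `t`, of a piece of the sphere of radius
`r` of `ℝⁿ⁺¹`, whose induced metric has the coefficients `Hᵢⱼ`. -/
structure IsSphericalParam (r : ℝ) (H : Euc n → Matrix (Fin n) (Fin n) ℝ)
    (F : Euc n → Euc (n + 1)) (t : Set (Euc n)) : Prop extends IsIsometricParam H F t where
  radius_pos : 0 < r
  norm_eq : ∀ y ∈ t, ‖F y‖ = r

namespace IsSphericalParam

variable {r : ℝ} {H : Euc n → Matrix (Fin n) (Fin n) ℝ}
  {F : Euc n → Euc (n + 1)} {t : Set (Euc n)} {y : Euc n}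

theorem mono {u : Set (Euc n)} (hF : IsSphericalParam r H F t) (hu : IsOpen u) (hut : u ⊆ t) :
    IsSphericalParam r H F u where
  isOpen := hu
  contDiffOn := hF.contDiffOn.mono hut
  linearIndependent y hy := hF.linearIndependent y (hut hy)
  coeff_eq y hy := hF.coeff_eq y (hut hy)
  radius_pos := hF.radius_pos
  norm_eq y hy := hF.norm_eq y (hut hy)

theorem inner_self_eq (hF : IsSphericalParam r H F t) (hy : y ∈ t) :
    inner ℝ (F y) (F y) = r ^ 2 := by
  rw [real_inner_self_eq_norm_sq, hF.norm_eq y hy]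

theorem inner_partialDeriv_self (hF : IsSphericalParam r H F t) (hy : y ∈ t) (i : Fin n) :
    inner ℝ (partialDeriv i F y) (F y) = 0 := by
  have hconst : pd i (fun z => inner ℝ (F z) (F z)) y = 0 :=
    (partialDeriv_congr hF.isOpen (fun z hz => hF.inner_self_eq hz) hy).trans
      (partialDeriv_const (r ^ 2))
  rw [pd_inner (hF.differentiableAt hy) (hF.differentiableAt hy), real_inner_comm] at hconst
  linarith

theorem inner_partialDeriv_partialDeriv_self (hF : IsSphericalParam r H F t) (hy : y ∈ t)
    (i j : Fin n) : inner ℝ (partialDeriv i (partialDeriv j F) y) (F y) = -H y i j := by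
  have hconst : pd i (fun z => inner ℝ (partialDeriv j F z) (F z)) y = 0 :=
    (partialDeriv_congr hF.isOpen (fun z hz => hF.inner_partialDeriv_self hz j) hy).trans
      (partialDeriv_const 0)
  rw [pd_inner (hF.differentiableAt_partialDeriv hy j) (hF.differentiableAt hy),
    real_inner_comm, ← hF.coeff_eq y hy] at hconst
  linarith

theorem eq_zero_of_inner_eq_zero (hF : IsSphericalParam r H F t) (hy : y ∈ t) {u : Euc (n + 1)}
    (hu : ∀ i, inner ℝ u (partialDeriv i F y) = 0) (hu' : inner ℝ u (F y) = 0) : u = 0 :=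
  eq_zero_of_inner_linearIndependent_eq_zero (hF.linearIndependent y hy)
    finrank_euclideanSpace_fin (norm_ne_zero_iff.1 (hF.norm_eq y hy ▸ hF.radius_pos.ne'))
    (hF.inner_partialDeriv_self hy) hu hu'

theorem hessian_eq (hF : IsSphericalParam r H F t) (hy : y ∈ t) (i j : Fin n) :
    hessian H F i j y = -((r ^ 2)⁻¹ * H y i j) • F y := by
  rw [neg_smul, ← add_eq_zero_iff_eq_neg]
  have hr := hF.radius_pos.ne'
  refine hF.eq_zero_of_inner_eq_zero hy (fun l => ?_) ?_
  · rw [inner_add_left, hF.inner_hessian_partialDeriv hy, real_inner_smul_left,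
      real_inner_comm, hF.inner_partialDeriv_self hy, mul_zero, add_zero]
  · simp only [hessian, inner_add_left, inner_sub_left, sum_inner, real_inner_smul_left,
      hF.inner_partialDeriv_partialDeriv_self hy, hF.inner_partialDeriv_self hy,
      hF.inner_self_eq hy, mul_zero, Finset.sum_const_zero]
    field_simp
    ring

theorem partialDeriv_partialDeriv_eq (hF : IsSphericalParam r H F t) (hy : y ∈ t) (i j : Fin n) :
    partialDeriv i (partialDeriv j F) y =
      ∑ k, christoffel H k i j y • partialDeriv k F y - ((r ^ 2)⁻¹ * H y i j) • F y := by
  have h := hF.hessian_eq hy i j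
  rw [hessian, sub_eq_iff_eq_add] at h
  rw [h, neg_smul]
  abel

theorem exists_partialDeriv_partialDeriv_partialDeriv_eq (hF : IsSphericalParam r H F t)
    (hy : y ∈ t) (a b c : Fin n) : ∃ q : ℝ,
    partialDeriv a (partialDeriv b (partialDeriv c F)) y =
      ∑ d, (pd a (christoffel H d b c) y + ∑ e, christoffel H d a e y * christoffel H e b c y) •
        partialDeriv d F y - ((r ^ 2)⁻¹ * H y b c) • partialDeriv a F y - q • F y := by
  have hΓ (e) : DifferentiableAt ℝ (christoffel H e b c) y :=
    ((hF.contDiffOn_christoffel e b c).contDiffAt (hF.isOpen.mem_nhds hy)).differentiableAt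
      (by simp)
  have hH : DifferentiableAt ℝ (fun z => -((r ^ 2)⁻¹ * H z b c)) y :=
    ((((hF.contDiffOn_coeff b c).contDiffAt (hF.isOpen.mem_nhds hy)).differentiableAt
      (by simp)).const_mul _).neg
  have hdF := hF.differentiableAt_partialDeriv hy
  have hexpand : partialDeriv a (partialDeriv b (partialDeriv c F)) y =
      partialDeriv a (fun z => ∑ e, christoffel H e b c z • partialDeriv e F z +
        (-((r ^ 2)⁻¹ * H z b c)) • F z) y :=
    partialDeriv_congr hF.isOpen (fun z hz => by
      rw [hF.partialDeriv_partialDeriv_eq hz, neg_smul, sub_eq_add_neg]) hy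
  refine ⟨∑ e, christoffel H e b c y * ((r ^ 2)⁻¹ * H y a e) -
    pd a (fun z => -((r ^ 2)⁻¹ * H z b c)) y, ?_⟩
  rw [hexpand, partialDeriv_add (.fun_sum fun e _ => (hΓ e).fun_smul (hdF e))
    (hH.fun_smul (hF.differentiableAt hy)), partialDeriv_smul hH (hF.differentiableAt hy),
    partialDeriv_sum fun e _ => (hΓ e).fun_smul (hdF e)]
  simp only [partialDeriv_smul (hΓ _) (hdF _), hF.partialDeriv_partialDeriv_eq hy, smul_sub,
    add_smul, sub_smul, Finset.sum_add_distrib, Finset.sum_sub_distrib, Finset.smul_sum,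
    Finset.sum_smul, smul_smul, neg_smul]
  rw [Finset.sum_comm]
  simp only [mul_comm (christoffel H _ b c y)]
  abel

theorem sum_curvatureCoeff_smul_partialDeriv (hF : IsSphericalParam r H F t) (hy : y ∈ t)
    (a b c : Fin n) :
    ∑ d, curvatureCoeff H d a b c y • partialDeriv d F y =
      (r ^ 2)⁻¹ • (H y b c • partialDeriv a F y - H y a c • partialDeriv b F y) := by
  obtain ⟨p, hp⟩ := hF.exists_partialDeriv_partialDeriv_partialDeriv_eq hy a b c
  obtain ⟨q, hq⟩ := hF.exists_partialDeriv_partialDeriv_partialDeriv_eq hy b a c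
  have hcomm : partialDeriv a (partialDeriv b (partialDeriv c F)) y =
      partialDeriv b (partialDeriv a (partialDeriv c F)) y :=
    partialDeriv_partialDeriv_comm (contDiffAt_infty.1
      ((hF.contDiffOn_partialDeriv c).contDiffAt (hF.isOpen.mem_nhds hy)) 2) a b
  have hcurv (d : Fin n) : curvatureCoeff H d a b c y =
      (pd a (christoffel H d b c) y + ∑ e, christoffel H d a e y * christoffel H e b c y) -
      (pd b (christoffel H d a c) y + ∑ e, christoffel H d b e y * christoffel H e a c y) := by
    rw [curvatureCoeff, Finset.sum_sub_distrib]
    ring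
  have hnormal : ∑ d, curvatureCoeff H d a b c y • partialDeriv d F y =
      (r ^ 2)⁻¹ • (H y b c • partialDeriv a F y - H y a c • partialDeriv b F y) +
        (p - q) • F y := by
    rw [hp, hq] at hcomm
    simp only [hcurv, sub_smul, Finset.sum_sub_distrib, smul_sub, smul_smul]
    linear_combination (norm := module) hcomm
  have hpq : p - q = 0 := by
    have h := congrArg (inner ℝ · (F y)) hnormal
    simp only [inner_add_left, inner_sub_left, sum_inner, real_inner_smul_left,
      hF.inner_partialDeriv_self hy, hF.inner_self_eq hy] at h
    simpa [hF.radius_pos.ne'] using h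
  rw [hnormal, hpq, zero_smul, add_zero]

end IsSphericalParam

end SphericalParam

section Along

variable {m n : ℕ} {G : Euc m → Matrix (Fin m) (Fin m) ℝ} {H : Euc n → Matrix (Fin n) (Fin n) ℝ}
  {ψ : Euc m → Euc n} {s : Set (Euc m)} {t : Set (Euc n)} {x : Euc m}

theorem partialDeriv_pushforward {V : Type*} [NormedAddCommGroup V] [NormedSpace ℝ V]
    {F : Euc n → V} (hF : ∀ c, DifferentiableAt ℝ (partialDeriv c F) (ψ x))
    (hψ : DifferentiableAt ℝ ψ x) {X : Euc m → Fin n → ℝ} (hX : DifferentiableAt ℝ X x)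
    (i : Fin m) :
    partialDeriv i (fun y => pushforward F (ψ y) (X y)) x =
      pushforward F (ψ x) (fun c => pd i (fun y => X y c) x) +
        ∑ c, X x c • pushforward (partialDeriv c F) (ψ x) fun b => pd i (fun y => ψ y b) x := by
  have hXc (c) : DifferentiableAt ℝ (fun y => X y c) x := differentiableAt_pi.1 hX c
  have hFψ (c) : DifferentiableAt ℝ (partialDeriv c F ∘ ψ) x := (hF c).comp x hψ
  change partialDeriv i (fun y => ∑ c, X y c • (partialDeriv c F ∘ ψ) y) x = _
  rw [partialDeriv_sum fun c _ => (hXc c).fun_smul (hFψ c)]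
  simp only [partialDeriv_smul (hXc _) (hFψ _), partialDeriv_comp (hF _) hψ]
  rw [Finset.sum_add_distrib, add_comm]
  rfl

section Smoothness

variable {V V' : Type*} [NormedAddCommGroup V] [InnerProductSpace ℝ V]
  [NormedAddCommGroup V'] [InnerProductSpace ℝ V'] {F : Euc n → V} {E : Euc m → V'}

theorem contDiffOn_pd_coord (hs : IsOpen s) (hψ : ContDiffOn ℝ ∞ ψ s) (i : Fin m) (a : Fin n) :
    ContDiffOn ℝ ∞ (pd i fun y => ψ y a) s :=
  contDiffOn_partialDeriv hs ((EuclideanSpace.proj (𝕜 := ℝ) a).contDiff.comp_contDiffOn hψ)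

theorem contDiffOn_covAlong (hF : IsIsometricParam H F t) (hs : IsOpen s)
    (hψ : ContDiffOn ℝ ∞ ψ s) (hst : Set.MapsTo ψ s t) {X : Euc m → Fin n → ℝ}
    (hX : ContDiffOn ℝ ∞ X s) (i : Fin m) : ContDiffOn ℝ ∞ (covAlong H ψ i X) s :=
  contDiffOn_pi.2 fun a =>
    (contDiffOn_partialDeriv hs (contDiffOn_pi.1 hX a)).add <| .sum fun b _ => .sum fun c _ =>
      (((hF.contDiffOn_christoffel a b c).comp hψ hst).mul (contDiffOn_pd_coord hs hψ i b)).mul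
        (contDiffOn_pi.1 hX c)

theorem contDiffOn_tensionCoord (hE : IsIsometricParam G E s) (hF : IsIsometricParam H F t)
    (hψ : ContDiffOn ℝ ∞ ψ s) (hst : Set.MapsTo ψ s t) :
    ContDiffOn ℝ ∞ (tensionCoord G H ψ) s :=
  contDiffOn_pi.2 fun a => .sum fun i _ => .sum fun j _ =>
    (hE.contDiffOn_inv_coeff i j).mul <|
      (contDiffOn_pi.1 (contDiffOn_covAlong hF hE.isOpen hψ hst
        (contDiffOn_pi.2 fun b => contDiffOn_pd_coord hE.isOpen hψ j b) i) a).sub <|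
      .sum fun k _ => (hE.contDiffOn_christoffel k i j).mul (contDiffOn_pd_coord hE.isOpen hψ k a)

end Smoothness

/-- The covariant derivative `∂ᵢW + κ⟪∂ᵢf, W⟫ f` along a map `f` into a sphere of curvature `κ`, of
a field `W` tangent to that sphere: the derivative in the ambient space, minus its component normal
to the sphere. -/
def sphericalCov {E : Type*} [NormedAddCommGroup E] [InnerProductSpace ℝ E] (κ : ℝ)
    (f : Euc m → E) (i : Fin m) (W : Euc m → E) (x : Euc m) : E :=
  partialDeriv i W x + (κ * inner ℝ (partialDeriv i f x) (W x)) • f x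

theorem IsIsometricParam.inner_pushforward {V : Type*} [NormedAddCommGroup V]
    [InnerProductSpace ℝ V] {F : Euc n → V} {y : Euc n}
    (hF : IsIsometricParam H F t) (hy : y ∈ t) (v w : Fin n → ℝ) :
    inner ℝ (pushforward F y v) (pushforward F y w) = ∑ b, ∑ c, v b * w c * H y b c := by
  rw [pushforward_apply, pushforward_apply, sum_inner]
  simp only [inner_sum, real_inner_smul_left, real_inner_smul_right, hF.coeff_eq y hy,
    mul_assoc, mul_left_comm]

theorem IsIsometricParam.pushforward_injective {V : Type*} [NormedAddCommGroup V]
    [InnerProductSpace ℝ V] {F : Euc n → V} {y : Euc n}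
    (hF : IsIsometricParam H F t) (hy : y ∈ t) : Function.Injective (pushforward F y) :=
  linearIndependent_iff_injective_fintypeLinearCombination.1 (hF.linearIndependent y hy)

namespace IsSphericalParam

variable {r : ℝ} {F : Euc n → Euc (n + 1)}

theorem pushforward_covAlong (hF : IsSphericalParam r H F t) (hψ : DifferentiableAt ℝ ψ x)
    (hx : ψ x ∈ t) {X : Euc m → Fin n → ℝ} (hX : DifferentiableAt ℝ X x) (i : Fin m) :
    pushforward F (ψ x) (covAlong H ψ i X x) =
      sphericalCov (r ^ 2)⁻¹ (F ∘ ψ) i (fun y => pushforward F (ψ y) (X y)) x := by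
  set ψ' : Fin n → ℝ := fun b => pd i (fun y => ψ y b) x with hψ'
  have hcov : covAlong H ψ i X x = (fun c => pd i (fun y => X y c) x) +
      ∑ b, ∑ c, (ψ' b * X x c) • fun a => christoffel H a b c (ψ x) := by
    ext a
    simp only [covAlong, Pi.add_apply, Finset.sum_apply, Pi.smul_apply, smul_eq_mul, hψ']
    congr! 3
    ring
  have hsnd : ∑ c, X x c • pushforward (partialDeriv c F) (ψ x) ψ' =
      ∑ b, ∑ c, (ψ' b * X x c) • partialDeriv b (partialDeriv c F) (ψ x) := by
    simp only [pushforward_apply, Finset.smul_sum, smul_smul]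
    rw [Finset.sum_comm]
    simp only [mul_comm]
  rw [sphericalCov, partialDeriv_pushforward (hF.differentiableAt_partialDeriv hx) hψ hX, hcov,
    partialDeriv_comp (hF.differentiableAt hx) hψ, hF.inner_pushforward hx, ← hψ', hsnd]
  simp only [map_add, map_sum, map_smul, hF.partialDeriv_partialDeriv_eq hx,
    pushforward_apply F _ fun a => christoffel H a _ _ _, smul_sub, Finset.sum_sub_distrib,
    Finset.mul_sum, Finset.sum_smul, smul_smul, Function.comp_apply, mul_left_comm]
  abel

theorem pushforward_curvature (hF : IsSphericalParam r H F t) {y : Euc n} (hy : y ∈ t)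
    (u v w : Fin n → ℝ) :
    pushforward F y (fun a => ∑ b, ∑ c, ∑ d, curvatureCoeff H a b c d y * u b * v c * w d) =
      (r ^ 2)⁻¹ • (inner ℝ (pushforward F y v) (pushforward F y w) • pushforward F y u -
        inner ℝ (pushforward F y u) (pushforward F y w) • pushforward F y v) := by
  have hsum : (fun a => ∑ b, ∑ c, ∑ d, curvatureCoeff H a b c d y * u b * v c * w d) =
      ∑ b, ∑ c, ∑ d, (u b * v c * w d) • fun a => curvatureCoeff H a b c d y := by
    ext a
    simp only [Finset.sum_apply, Pi.smul_apply, smul_eq_mul, mul_comm, mul_left_comm]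
  have hGauss (b c d) : pushforward F y (fun a => curvatureCoeff H a b c d y) =
      (r ^ 2)⁻¹ • (H y c d • partialDeriv b F y - H y b d • partialDeriv c F y) :=
    hF.sum_curvatureCoeff_smul_partialDeriv hy b c d
  simp only [hsum, map_sum, map_smul, hGauss, hF.inner_pushforward hy, smul_sub,
    Finset.sum_sub_distrib]
  congr 1
  · simp only [pushforward_apply F y u, Finset.smul_sum, Finset.sum_smul, Finset.sum_mul,
      smul_smul]
    refine Finset.sum_congr rfl fun b _ => Finset.sum_congr rfl fun c _ =>
      Finset.sum_congr rfl fun d _ => ?_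
    congr 1
    ring
  · rw [Finset.sum_comm]
    simp only [pushforward_apply F y v, Finset.smul_sum, Finset.sum_smul, Finset.sum_mul,
      smul_smul]
    refine Finset.sum_congr rfl fun c _ => Finset.sum_congr rfl fun b _ =>
      Finset.sum_congr rfl fun d _ => ?_
    congr 1
    ring

end IsSphericalParam

theorem sphericalCov_congr {V : Type*} [NormedAddCommGroup V] [InnerProductSpace ℝ V] {κ : ℝ}
    {f W W' : Euc m → V} (hs : IsOpen s) (h : Set.EqOn W W' s) (i : Fin m) :
    Set.EqOn (sphericalCov κ f i W) (sphericalCov κ f i W') s := fun x hx => by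
  rw [sphericalCov, sphericalCov, partialDeriv_congr hs h hx, h hx]

namespace IsSphericalParam

variable {r : ℝ} {F : Euc n → Euc (n + 1)}

theorem pushforward_tensionCoord (hF : IsSphericalParam r H F t) (hs : IsOpen s)
    (hψ : ContDiffOn ℝ ∞ ψ s) (hst : Set.MapsTo ψ s t) (hx : x ∈ s) :
    pushforward F (ψ x) (tensionCoord G H ψ x) =
      ∑ i, ∑ j, (G x)⁻¹ i j • (hessian G (F ∘ ψ) i j x +
        ((r ^ 2)⁻¹ * inner ℝ (partialDeriv i (F ∘ ψ) x) (partialDeriv j (F ∘ ψ) x)) •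
          F (ψ x)) := by
  have hψ_diff {y : Euc m} (hy : y ∈ s) : DifferentiableAt ℝ ψ y :=
    (hψ.contDiffAt (hs.mem_nhds hy)).differentiableAt (by simp)
  have hdψ (j : Fin m) : DifferentiableAt ℝ (fun y b => pd j (fun z => ψ z b) y) x :=
    ((contDiffOn_pi.2 fun b => contDiffOn_pd_coord hs hψ j b).contDiffAt
      (hs.mem_nhds hx)).differentiableAt (by simp)
  have hdf (j : Fin m) : Set.EqOn (partialDeriv j (F ∘ ψ))
      (fun y => pushforward F (ψ y) fun b => pd j (fun z => ψ z b) y) s := fun y hy =>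
    partialDeriv_comp (hF.differentiableAt (hst hy)) (hψ_diff hy)
  have hτ : tensionCoord G H ψ x = ∑ i, ∑ j, (G x)⁻¹ i j •
      (covAlong H ψ i (fun y b => pd j (fun z => ψ z b) y) x -
        ∑ k, christoffel G k i j x • fun a => pd k (fun y => ψ y a) x) := by
    ext a
    simp [tensionCoord]
  simp only [hτ, map_sum, map_smul, map_sub,
    hF.pushforward_covAlong (hψ_diff hx) (hst hx) (hdψ _), ← sphericalCov_congr hs (hdf _) _ hx,
    ← hdf _ hx]
  refine Finset.sum_congr rfl fun i _ => Finset.sum_congr rfl fun j _ => ?_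
  rw [sphericalCov, hessian, Function.comp_apply, add_sub_right_comm]

theorem pushforward_bitensionCoord {V : Type*} [NormedAddCommGroup V] [InnerProductSpace ℝ V]
    {E : Euc m → V} {W : Euc m → Euc (n + 1)} (hF : IsSphericalParam r H F t)
    (hE : IsIsometricParam G E s) (hψ : ContDiffOn ℝ ∞ ψ s) (hst : Set.MapsTo ψ s t)
    (hW : ∀ y ∈ s, pushforward F (ψ y) (tensionCoord G H ψ y) = W y) (hx : x ∈ s) :
    pushforward F (ψ x) (bitensionCoord G H ψ x) =
      ∑ i, ∑ j, (G x)⁻¹ i j •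
        (sphericalCov (r ^ 2)⁻¹ (F ∘ ψ) i (sphericalCov (r ^ 2)⁻¹ (F ∘ ψ) j W) x -
          ∑ k, christoffel G k i j x • sphericalCov (r ^ 2)⁻¹ (F ∘ ψ) k W x) -
      ∑ i, ∑ j, (G x)⁻¹ i j • (r ^ 2)⁻¹ •
        (inner ℝ (W x) (partialDeriv j (F ∘ ψ) x) • partialDeriv i (F ∘ ψ) x -
          inner ℝ (partialDeriv i (F ∘ ψ) x) (partialDeriv j (F ∘ ψ) x) • W x) := by
  have diff {p : ℕ} {X : Euc m → Fin p → ℝ} (hX : ContDiffOn ℝ ∞ X s) {y : Euc m} (hy : y ∈ s) :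
      DifferentiableAt ℝ X y :=
    (hX.contDiffAt (hE.isOpen.mem_nhds hy)).differentiableAt (by simp)
  have hψ_diff {y : Euc m} (hy : y ∈ s) : DifferentiableAt ℝ ψ y :=
    (hψ.contDiffAt (hE.isOpen.mem_nhds hy)).differentiableAt (by simp)
  have hτ := contDiffOn_tensionCoord hE hF.toIsIsometricParam hψ hst
  have hcov (j : Fin m) : Set.EqOn
      (fun y => pushforward F (ψ y) (covAlong H ψ j (tensionCoord G H ψ) y))
      (sphericalCov (r ^ 2)⁻¹ (F ∘ ψ) j W) s := fun y hy =>
    (hF.pushforward_covAlong (hψ_diff hy) (hst hy) (diff hτ hy) j).trans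
      (sphericalCov_congr hE.isOpen hW j hy)
  have hcov_cov (i j : Fin m) :
      pushforward F (ψ x) (covAlong H ψ i (covAlong H ψ j (tensionCoord G H ψ)) x) =
        sphericalCov (r ^ 2)⁻¹ (F ∘ ψ) i (sphericalCov (r ^ 2)⁻¹ (F ∘ ψ) j W) x :=
    (hF.pushforward_covAlong (hψ_diff hx) (hst hx) (diff (contDiffOn_covAlong
      hF.toIsIsometricParam hE.isOpen hψ hst hτ j) hx) i).trans
      (sphericalCov_congr hE.isOpen (hcov j) i hx)
  have hτ₂ : bitensionCoord G H ψ x =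
      ∑ i, ∑ j, (G x)⁻¹ i j • (covAlong H ψ i (covAlong H ψ j (tensionCoord G H ψ)) x -
        ∑ k, christoffel G k i j x • covAlong H ψ k (tensionCoord G H ψ) x) -
      ∑ i, ∑ j, (G x)⁻¹ i j • fun a => ∑ b, ∑ c, ∑ d, curvatureCoeff H a b c d (ψ x) *
        pd i (fun y => ψ y b) x * tensionCoord G H ψ x c * pd j (fun y => ψ y d) x := by
    ext a
    simp [bitensionCoord]
  simp only [hτ₂, map_sub, map_sum, map_smul, hcov_cov, fun k => hcov k hx,
    hF.pushforward_curvature (hst hx), hW x hx,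
    ← partialDeriv_comp (hF.differentiableAt (hst hx)) (hψ_diff hx)]

end IsSphericalParam

end Along

section Umbilic

variable {m n : ℕ} {V : Type*} [NormedAddCommGroup V] [InnerProductSpace ℝ V]

/-- On `s`, the map `f` into a sphere of curvature `κ` is a totally umbilical isometric immersion of
the metric `G`: its second fundamental form in the sphere is `Gᵢⱼ η`, and `∂ᵢη = -ℓ ∂ᵢf`, so that
`η` is parallel in the normal bundle and the shape operator in its direction is `ℓ`. -/
structure IsParallelUmbilic (κ ℓ : ℝ) (G : Euc m → Matrix (Fin m) (Fin m) ℝ) (f η : Euc m → V)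
    (s : Set (Euc m)) : Prop extends IsIsometricParam G f s where
  hessian_add : ∀ x ∈ s, ∀ i j, hessian G f i j x + (κ * G x i j) • f x = G x i j • η x
  partialDeriv_eq : ∀ x ∈ s, ∀ i, partialDeriv i η x = -(ℓ • partialDeriv i f x)
  differentiableAt_normal : ∀ x ∈ s, DifferentiableAt ℝ η x
  inner_partialDeriv : ∀ x ∈ s, ∀ i, inner ℝ (partialDeriv i f x) (η x) = 0

namespace IsParallelUmbilic

variable {r ℓ : ℝ} {G : Euc m → Matrix (Fin m) (Fin m) ℝ} {H : Euc n → Matrix (Fin n) (Fin n) ℝ}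
  {ψ : Euc m → Euc n} {s : Set (Euc m)} {t : Set (Euc n)} {x : Euc m}

theorem sphericalCov_normal {κ : ℝ} {f η : Euc m → V} (hf : IsParallelUmbilic κ ℓ G f η s) (c : ℝ)
    (hx : x ∈ s) (i : Fin m) :
    sphericalCov κ f i (fun y => c • η y) x = -(c * ℓ) • partialDeriv i f x := by
  rw [sphericalCov, partialDeriv_smul (differentiableAt_const c) (hf.differentiableAt_normal x hx),
    hf.partialDeriv_eq x hx, real_inner_smul_right, hf.inner_partialDeriv x hx]
  have : pd i (fun _ => c) x = 0 := partialDeriv_const c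
  rw [this]
  module

theorem sphericalCov_sphericalCov_normal_sub {κ : ℝ} {f η : Euc m → V}
    (hf : IsParallelUmbilic κ ℓ G f η s) (c : ℝ) (hx : x ∈ s) (i j : Fin m) :
    sphericalCov κ f i (sphericalCov κ f j fun y => c • η y) x -
        ∑ k, christoffel G k i j x • sphericalCov κ f k (fun y => c • η y) x =
      -(c * ℓ * G x i j) • η x := by
  have hcov (j : Fin m) : Set.EqOn (sphericalCov κ f j fun y => c • η y)
      (fun y => -(c * ℓ) • partialDeriv j f y) s :=
    fun y hy => hf.sphericalCov_normal c hy j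
  simp only [fun k => hcov k hx, sphericalCov_congr hf.isOpen (hcov j) i hx]
  rw [sphericalCov, partialDeriv_smul (differentiableAt_const _)
    (hf.differentiableAt_partialDeriv hx j), real_inner_smul_right, ← hf.coeff_eq x hx]
  have hconst : pd i (fun _ => -(c * ℓ)) x = 0 := partialDeriv_const (-(c * ℓ))
  have h := hf.hessian_add x hx i j
  rw [hessian] at h
  simp only [hconst, smul_comm _ (-(c * ℓ)), ← Finset.smul_sum]
  linear_combination (norm := module) (-(c * ℓ)) • h

variable {F : Euc n → Euc (n + 1)} {η : Euc m → Euc (n + 1)}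

theorem pushforward_tensionCoord (hf : IsParallelUmbilic (r ^ 2)⁻¹ ℓ G (F ∘ ψ) η s)
    (hF : IsSphericalParam r H F t) (hψ : ContDiffOn ℝ ∞ ψ s) (hst : Set.MapsTo ψ s t)
    (hx : x ∈ s) : pushforward F (ψ x) (tensionCoord G H ψ x) = (m : ℝ) • η x := by
  simp only [hF.pushforward_tensionCoord hf.isOpen hψ hst hx, ← hf.coeff_eq x hx]
  simp only [← Function.comp_apply (f := F), hf.hessian_add x hx, smul_smul, ← Finset.sum_smul,
    hf.sum_inv_mul_coeff hx]

theorem pushforward_bitensionCoord (hf : IsParallelUmbilic (r ^ 2)⁻¹ ℓ G (F ∘ ψ) η s)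
    (hF : IsSphericalParam r H F t) (hψ : ContDiffOn ℝ ∞ ψ s) (hst : Set.MapsTo ψ s t)
    (hx : x ∈ s) : pushforward F (ψ x) (bitensionCoord G H ψ x) =
      ((m : ℝ) ^ 2 * ((r ^ 2)⁻¹ - ℓ)) • η x := by
  rw [hF.pushforward_bitensionCoord hf.toIsIsometricParam hψ hst
    (fun y hy => hf.pushforward_tensionCoord hF hψ hst hy) hx]
  simp only [hf.sphericalCov_sphericalCov_normal_sub m hx, ← hf.coeff_eq x hx, real_inner_smul_left,
    real_inner_comm (partialDeriv _ (F ∘ ψ) x) (η x), hf.inner_partialDeriv x hx, mul_zero]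
  simp only [zero_smul, zero_sub, ← neg_smul, smul_smul, ← Finset.sum_smul, ← sub_smul]
  congr 1
  have htrace := hf.sum_inv_mul_coeff hx
  calc _ = (m * ((r ^ 2)⁻¹ - ℓ)) * ∑ i, ∑ j, (G x)⁻¹ i j * G x i j := by
        simp only [Finset.mul_sum, ← Finset.sum_sub_distrib]
        refine Finset.sum_congr rfl fun i _ => Finset.sum_congr rfl fun j _ => ?_
        ring
    _ = _ := by rw [htrace]; ring

end IsParallelUmbilic

end Umbilic

section UmbilicSmallSphere

variable {m : ℕ} {V : Type*} [NormedAddCommGroup V] [InnerProductSpace ℝ V] {r : ℝ}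
  {G : Euc m → Matrix (Fin m) (Fin m) ℝ} {s : Set (Euc m)} {x : Euc m}
  {f : Euc m → V} {b : V}

section Isometry

variable {V' : Type*} [NormedAddCommGroup V'] [InnerProductSpace ℝ V'] {E : Euc m → V'}
  {A : V' →ₗᵢ[ℝ] V}

theorem IsIsometricParam.partialDeriv_isometry_add (hE : IsIsometricParam G E s)
    (hf : ∀ x ∈ s, f x = A (E x) + b) (i : Fin m) :
    Set.EqOn (partialDeriv i f) (fun x => A (partialDeriv i E x)) s := fun x hx =>
  calc partialDeriv i f x = partialDeriv i (fun y => A.toContinuousLinearMap (E y) + b) x :=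
        partialDeriv_congr hE.isOpen hf hx
    _ = A (partialDeriv i E x) := by
        rw [partialDeriv_add_const (fun y => A.toContinuousLinearMap (E y)),
          partialDeriv_clm_apply _ (hE.differentiableAt hx)]
        rfl

theorem IsIsometricParam.isometry_add (hE : IsIsometricParam G E s)
    (hf : ∀ x ∈ s, f x = A (E x) + b) : IsIsometricParam G f s where
  isOpen := hE.isOpen
  contDiffOn := ((A.contDiff.comp_contDiffOn hE.contDiffOn).add contDiffOn_const).congr hf
  linearIndependent x hx := by
    simp only [hE.partialDeriv_isometry_add hf _ hx]
    exact (hE.linearIndependent x hx).map' A.toLinearMap (LinearMap.ker_eq_bot.2 A.injective)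
  coeff_eq x hx i j := by
    rw [hE.partialDeriv_isometry_add hf _ hx, hE.partialDeriv_isometry_add hf _ hx,
      A.inner_map_map, hE.coeff_eq x hx]

theorem IsIsometricParam.hessian_isometry_add (hE : IsIsometricParam G E s)
    (hf : ∀ x ∈ s, f x = A (E x) + b) (hx : x ∈ s) (i j : Fin m) :
    hessian G f i j x = A (hessian G E i j x) := by
  have hsnd : partialDeriv i (partialDeriv j f) x = A (partialDeriv i (partialDeriv j E) x) :=
    (partialDeriv_congr hE.isOpen (hE.partialDeriv_isometry_add hf j) hx).trans
      (partialDeriv_clm_apply A.toContinuousLinearMap (hE.differentiableAt_partialDeriv hx j))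
  simp only [hessian, hsnd, hE.partialDeriv_isometry_add hf _ hx, map_sub, map_sum, map_smul]

end Isometry

theorem IsSphericalParam.isParallelUmbilic {E : Euc m → Euc (m + 1)} {A : Euc (m + 1) →ₗᵢ[ℝ] V}
    (hE : IsSphericalParam r G E s) (hA : ∀ v, inner ℝ (A v) b = 0)
    (hf : ∀ x ∈ s, f x = A (E x) + b) (κ : ℝ) :
    IsParallelUmbilic κ ((r ^ 2)⁻¹ - κ) G f (fun x => κ • b - ((r ^ 2)⁻¹ - κ) • A (E x)) s where
  toIsIsometricParam := hE.isometry_add hf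
  hessian_add x hx i j := by
    rw [hE.hessian_isometry_add hf hx, hE.hessian_eq hx, hf x hx, map_smul]
    module
  partialDeriv_eq x hx i := by
    have hη : (fun x => κ • b - ((r ^ 2)⁻¹ - κ) • A (E x)) =
        fun x => ((κ - (r ^ 2)⁻¹) • A.toContinuousLinearMap) (E x) + κ • b := by
      ext x
      simp only [FunLike.coe_smul, Pi.smul_apply, LinearIsometry.coe_toContinuousLinearMap]
      module
    rw [hη, partialDeriv_add_const (fun x => ((κ - (r ^ 2)⁻¹) • A.toContinuousLinearMap) (E x)),
      partialDeriv_clm_apply _ (hE.differentiableAt hx),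
      hE.partialDeriv_isometry_add hf _ hx]
    simp only [FunLike.coe_smul, Pi.smul_apply, LinearIsometry.coe_toContinuousLinearMap]
    module
  differentiableAt_normal x hx := (differentiableAt_const _).sub
    ((A.toContinuousLinearMap.differentiableAt.comp x (hE.differentiableAt hx)).const_smul _)
  inner_partialDeriv x hx i := by
    rw [hE.partialDeriv_isometry_add hf _ hx, inner_sub_right, real_inner_smul_right,
      real_inner_smul_right, hA, A.inner_map_map, hE.inner_partialDeriv_self hx, mul_zero,
      mul_zero, sub_zero]

variable {n : ℕ} {H : Euc n → Matrix (Fin n) (Fin n) ℝ} {F : Euc n → Euc (n + 1)}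
  {t : Set (Euc n)} {ψ : Euc m → Euc n} {E : Euc m → Euc (m + 1)}
  {A : Euc (m + 1) →ₗᵢ[ℝ] Euc (n + 1)} {b : Euc (n + 1)} {ρ : ℝ}

theorem tensionCoord_ne_zero (hE : IsSphericalParam r G E s) (hF : IsSphericalParam ρ H F t)
    (hψ : ContDiffOn ℝ ∞ ψ s) (hst : Set.MapsTo ψ s t) (hA : ∀ v, inner ℝ (A v) b = 0)
    (hf : ∀ x ∈ s, F (ψ x) = A (E x) + b) (hm : m ≠ 0) (hb : b ≠ 0) (hx : x ∈ s) :
    tensionCoord G H ψ x ≠ 0 := by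
  intro h0
  have hτ := (hE.isParallelUmbilic hA (f := F ∘ ψ) hf (ρ ^ 2)⁻¹).pushforward_tensionCoord
    hF hψ hst hx
  have hη : (ρ ^ 2)⁻¹ • b - ((r ^ 2)⁻¹ - (ρ ^ 2)⁻¹) • A (E x) = 0 := by
    simpa [h0, hm] using hτ.symm
  have hinner := congrArg (inner ℝ · b) hη
  simp [inner_sub_left, real_inner_smul_left, hA, hb, hF.radius_pos.ne'] at hinner

theorem bitensionCoord_eq_zero (hE : IsSphericalParam r G E s) (hF : IsSphericalParam ρ H F t)
    (hψ : ContDiffOn ℝ ∞ ψ s) (hst : Set.MapsTo ψ s t) (hA : ∀ v, inner ℝ (A v) b = 0)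
    (hf : ∀ x ∈ s, F (ψ x) = A (E x) + b) (hr : ρ ^ 2 = 2 * r ^ 2) (hx : x ∈ s) :
    bitensionCoord G H ψ x = 0 := by
  have hτ₂ := (hE.isParallelUmbilic hA (f := F ∘ ψ) hf (ρ ^ 2)⁻¹).pushforward_bitensionCoord
    hF hψ hst hx
  have hcurv : (ρ ^ 2)⁻¹ - ((r ^ 2)⁻¹ - (ρ ^ 2)⁻¹) = 0 := by
    rw [hr]
    ring
  rw [hcurv, mul_zero, zero_smul] at hτ₂
  exact hF.pushforward_injective (hst hx) (hτ₂.trans (map_zero _).symm)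

end UmbilicSmallSphere

section IsometricImmersion

variable {k m n : ℕ} {M N : Type*}
  [TopologicalSpace M] [ChartedSpace (Euc m) M] [TopologicalSpace N] [ChartedSpace (Euc n) N]

/-- The inclusion in `ℝⁿ⁺¹` of the sphere of radius `r`, the latter being identified with the unit
sphere as in `sphereMetric`. -/
def sphereIncl (r : ℝ) (u : Sph n) : Euc (n + 1) := r • (u : Euc (n + 1))

theorem contMDiff_sphereIncl (r : ℝ) :
    ContMDiff (𝓡 n) 𝓘(ℝ, Euc (n + 1)) ∞ (sphereIncl r : Sph n → Euc (n + 1)) := by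
  have : Fact (Module.finrank ℝ (Euc (n + 1)) = n + 1) := ⟨finrank_euclideanSpace_fin⟩
  exact (contDiff_const_smul (𝕜 := ℝ) (F := Euc (n + 1)) r).contMDiff.comp
    (contMDiff_coe_sphere (E := Euc (n + 1)) (n := n))

theorem pullbackForm_comp_apply {f : N → Euc k} {φ : M → N} {p : M}
    (hf : MDifferentiableAt (𝓡 n) 𝓘(ℝ, Euc k) f (φ p)) (hφ : MDifferentiableAt (𝓡 m) (𝓡 n) φ p)
    (u v : TangentSpace (𝓡 m) p) :
    pullbackForm (f ∘ φ) p u v =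
      pullbackForm f (φ p) (mfderiv (𝓡 m) (𝓡 n) φ p u) (mfderiv (𝓡 m) (𝓡 n) φ p v) := by
  have h (w : TangentSpace (𝓡 m) p) : mvfderiv (𝓡 m) (f ∘ φ) p w =
      mvfderiv (𝓡 n) f (φ p) (mfderiv (𝓡 m) (𝓡 n) φ p w) := mfderiv_comp_apply p hf hφ w
  exact congrArg₂ (inner ℝ) (h u) (h v)

theorem pullbackForm_euclidean_apply (f : Euc m → Euc k) (x u v : Euc m) :
    pullbackForm f x u v = inner ℝ (fderiv ℝ f x u) (fderiv ℝ f x v) := by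
  have h (w : Euc m) : mvfderiv (𝓡 m) f x w = fderiv ℝ f x w := by
    rw [← mfderiv_eq_fderiv]
    rfl
  exact congrArg₂ (inner ℝ) (h u) (h v)

theorem pullbackForm_isometry_add {l : ℕ} (A : Euc k →ₗᵢ[ℝ] Euc l) (b : Euc l) {f : M → Euc k}
    {p : M} (hf : MDifferentiableAt (𝓡 m) 𝓘(ℝ, Euc k) f p) :
    pullbackForm (m := m) (fun q => A (f q) + b) p = pullbackForm f p := by
  ext u v
  have hd (w : TangentSpace (𝓡 m) p) :
      mvfderiv (𝓡 m) (fun q => A (f q) + b) p w = A (mvfderiv (𝓡 m) f p w) := by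
    have hA : HasFDerivAt (fun x => A x + b) A.toContinuousLinearMap (f p) :=
      A.toContinuousLinearMap.hasFDerivAt.add_const b
    exact congrArg (· w) (hA.hasMFDerivAt.comp p hf.hasMFDerivAt).mfderiv
  exact (congrArg₂ (inner ℝ) (hd u) (hd v)).trans (A.inner_map_map _ _)

variable [IsManifold (𝓡 m) ∞ M] [IsManifold (𝓡 n) ∞ N] {g : Riem m M} {h : Riem n N}

theorem contMDiff_sphere_iff {r : ℝ} (hr : r ≠ 0) {f : M → Sph n} :
    ContMDiff (𝓡 m) (𝓡 n) ∞ f ↔ ContMDiff (𝓡 m) 𝓘(ℝ, Euc (n + 1)) ∞ (sphereIncl r ∘ f) := by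
  refine ⟨(contMDiff_sphereIncl r).comp, fun hf => ?_⟩
  have : Fact (Module.finrank ℝ (Euc (n + 1)) = n + 1) := ⟨finrank_euclideanSpace_fin⟩
  have hcoe : (fun p => (f p : Euc (n + 1))) = (r⁻¹ • ·) ∘ (sphereIncl r ∘ f) := by
    ext1 p
    exact (inv_smul_smul₀ hr _).symm
  have hsmooth : ContMDiff (𝓡 m) 𝓘(ℝ, Euc (n + 1)) ∞ fun p => (f p : Euc (n + 1)) := by
    rw [hcoe]
    exact (contDiff_const_smul (𝕜 := ℝ) (F := Euc (n + 1)) r⁻¹).contMDiff.comp hf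
  exact hsmooth.codRestrict_sphere _

theorem isIsometricImmersion_id : IsIsometricImmersion g g id :=
  ⟨contMDiff_id, fun p u v => by simp⟩

theorem isIsometricImmersion_sphereMetric_iff {r : ℝ} (hr : 0 < r) {f : M → Sph n} :
    IsIsometricImmersion g (sphereMetric n r hr) f ↔
      ContMDiff (𝓡 m) (𝓡 n) ∞ f ∧ ∀ p, g.inner p = pullbackForm (sphereIncl r ∘ f) p := by
  refine and_congr_right fun hf => forall_congr' fun p => ?_
  have hpull (u v : TangentSpace (𝓡 m) p) := pullbackForm_comp_apply
    ((contMDiff_sphereIncl r (f p)).mdifferentiableAt (by simp))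
    ((hf p).mdifferentiableAt (by simp)) u v
  refine ⟨fun h => ?_, fun h u v => ?_⟩
  · ext u v
    exact (h u v).symm.trans (hpull u v).symm
  · rw [h]
    exact (hpull u v).symm

namespace IsIsometricImmersion

theorem comp {l : ℕ} {P : Type*} [TopologicalSpace P] [ChartedSpace (Euc l) P]
    [IsManifold (𝓡 l) ∞ P] {q : Riem l P} {ψ : N → P} {φ : M → N}
    (hψ : IsIsometricImmersion h q ψ) (hφ : IsIsometricImmersion g h φ) :
    IsIsometricImmersion g q (ψ ∘ φ) :=
  ⟨hψ.1.comp hφ.1, fun p u v => by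
    simp only [mfderiv_comp p ((hψ.1 (φ p)).mdifferentiableAt (by simp))
      ((hφ.1 p).mdifferentiableAt (by simp))]
    exact (hψ.2 (φ p) _ _).trans (hφ.2 p u v)⟩

theorem of_eq_comp {l : ℕ} {P : Type*} [TopologicalSpace P] [ChartedSpace (Euc l) P]
    [IsManifold (𝓡 l) ∞ P] {q : Riem l P} {χ : M → P} {ψ : N → P} {φ : M → N}
    (hχ : IsIsometricImmersion g q χ) (hψ : IsIsometricImmersion h q ψ)
    (hφ : ContMDiff (𝓡 m) (𝓡 n) ∞ φ) (hcomp : ∀ p, χ p = ψ (φ p)) :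
    IsIsometricImmersion g h φ := by
  obtain rfl : χ = ψ ∘ φ := funext hcomp
  refine ⟨hφ, fun p u v => ?_⟩
  have huv := hχ.2 p u v
  simp only [mfderiv_comp p ((hψ.1 (φ p)).mdifferentiableAt (by simp))
    ((hφ p).mdifferentiableAt (by simp))] at huv
  exact (hψ.2 (φ p) _ _).symm.trans huv

theorem isometry_add {r ρ : ℝ} {hr : 0 < r} {κ : M → Sph m}
    (hκ : IsIsometricImmersion g (sphereMetric m r hr) κ) (hρ : 0 < ρ)
    {A : Euc (m + 1) →ₗᵢ[ℝ] Euc (n + 1)} {b : Euc (n + 1)} {f : M → Sph n}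
    (hf : ∀ p, sphereIncl ρ (f p) = A (sphereIncl r (κ p)) + b) :
    IsIsometricImmersion g (sphereMetric n ρ hρ) f := by
  obtain ⟨hκ_smooth, hκ_inner⟩ := (isIsometricImmersion_sphereMetric_iff hr).1 hκ
  have hincl := (contMDiff_sphereIncl r).comp hκ_smooth
  have hcomp : sphereIncl ρ ∘ f = fun p => A ((sphereIncl r ∘ κ) p) + b := funext hf
  refine (isIsometricImmersion_sphereMetric_iff hρ).2
    ⟨(contMDiff_sphere_iff hρ.ne').2 ?_, fun p => ?_⟩
  · rw [hcomp]
    exact (A.contDiff.add contDiff_const).contMDiff.comp hincl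
  · rw [hκ_inner, hcomp, pullbackForm_isometry_add A b ((hincl p).mdifferentiableAt (by simp))]

end IsIsometricImmersion

theorem isIsometricParam_comp_chart_symm {f : M → Euc k}
    (hf : ContMDiff (𝓡 m) 𝓘(ℝ, Euc k) ∞ f) (hg : ∀ p, g.inner p = pullbackForm f p) (p : M) :
    IsIsometricParam (metricCoeff g (chartAt (Euc m) p)) (f ∘ (chartAt (Euc m) p).symm)
      (chartAt (Euc m) p).target := by
  set e := chartAt (Euc m) p
  have he {x : Euc m} (hx : x ∈ e.target) : MDifferentiableAt (𝓡 m) (𝓡 m) e.symm x :=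
    ((contMDiffOn_chart_symm (n := ∞)).contMDiffAt
      (e.open_target.mem_nhds hx)).mdifferentiableAt (by simp)
  have hmetric {x : Euc m} (hx : x ∈ e.target) (u v : Euc m) :
      g.inner (e.symm x) (mfderiv (𝓡 m) (𝓡 m) e.symm x u) (mfderiv (𝓡 m) (𝓡 m) e.symm x v) =
        inner ℝ (fderiv ℝ (f ∘ e.symm) x u) (fderiv ℝ (f ∘ e.symm) x v) := by
    rw [← pullbackForm_euclidean_apply, hg]
    exact (pullbackForm_comp_apply ((hf _).mdifferentiableAt (by simp)) (he hx) u v).symm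
  refine ⟨e.open_target, (hf.comp_contMDiffOn contMDiffOn_chart_symm).contDiffOn,
    fun x hx => ?_, fun x hx i j => hmetric hx _ _⟩
  have hinj (v : Euc m) (hv : fderiv ℝ (f ∘ e.symm) x v = 0) : v = 0 := by
    by_contra hv0
    have hpos := g.pos (e.symm x) (mfderiv (𝓡 m) (𝓡 m) e.symm x v)
      (((mdifferentiable_chart p).symm.mfderiv_injective hx).ne_iff' (map_zero _) |>.2 hv0)
    rw [hmetric hx, hv, inner_zero_left] at hpos
    exact hpos.false
  have hbasis := (EuclideanSpace.basisFun (Fin m) ℝ).toBasis.linearIndependent.map'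
    (fderiv ℝ (f ∘ e.symm) x).toLinearMap (LinearMap.ker_eq_bot'.2 hinj)
  have heq : (fderiv ℝ (f ∘ e.symm) x).toLinearMap ∘
      (EuclideanSpace.basisFun (Fin m) ℝ).toBasis = fun i => partialDeriv i (f ∘ e.symm) x := by
    ext1 i
    simp [partialDeriv]
  exact heq ▸ hbasis

theorem isSphericalParam_comp_chart_symm {r : ℝ} {hr : 0 < r} {κ : M → Sph m}
    (hκ : IsIsometricImmersion g (sphereMetric m r hr) κ) (p : M) :
    IsSphericalParam r (metricCoeff g (chartAt (Euc m) p))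
      (fun x => sphereIncl r (κ ((chartAt (Euc m) p).symm x))) (chartAt (Euc m) p).target where
  toIsIsometricParam :=
    have hincl := (isIsometricImmersion_sphereMetric_iff hr).1 hκ
    isIsometricParam_comp_chart_symm ((contMDiff_sphereIncl r).comp hincl.1) hincl.2 p
  radius_pos := hr
  norm_eq x _ := by
    rw [sphereIncl, norm_smul, norm_eq_of_mem_sphere, mul_one, Real.norm_of_nonneg hr.le]

end IsometricImmersion

section LocalRepresentation

variable {m n : ℕ} {M N : Type*}
  [TopologicalSpace M] [ChartedSpace (Euc m) M] [TopologicalSpace N] [ChartedSpace (Euc n) N]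

/-- The points of the chart domain at `p` which `φ` maps to the chart domain at `φ p`: this is where
`localRep φ p` represents `φ`. -/
def localRepDomain (m n : ℕ) {M N : Type*} [TopologicalSpace M] [ChartedSpace (Euc m) M]
    [TopologicalSpace N] [ChartedSpace (Euc n) N] (φ : M → N) (p : M) : Set (Euc m) :=
  (chartAt (Euc m) p).target ∩
    (chartAt (Euc m) p).symm ⁻¹' (φ ⁻¹' (chartAt (Euc n) (φ p)).source)

theorem isOpen_localRepDomain {φ : M → N} (hφ : Continuous φ) (p : M) :
    IsOpen (localRepDomain m n φ p) :=
  (chartAt (Euc m) p).isOpen_inter_preimage_symm ((chartAt (Euc n) (φ p)).open_source.preimage hφ)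

theorem chartAt_mem_localRepDomain (φ : M → N) (p : M) :
    chartAt (Euc m) p p ∈ localRepDomain m n φ p := by
  refine ⟨mem_chart_target _ p, ?_⟩
  rw [Set.mem_preimage, (chartAt (Euc m) p).left_inv (mem_chart_source _ p)]
  exact mem_chart_source _ (φ p)

theorem mapsTo_localRep (φ : M → N) (p : M) :
    Set.MapsTo (localRep (m := m) (n := n) φ p) (localRepDomain m n φ p)
      (chartAt (Euc n) (φ p)).target :=
  fun _ hx => (chartAt (Euc n) (φ p)).map_source hx.2

theorem chartAt_symm_localRep {φ : M → N} {p : M} {x : Euc m} (hx : x ∈ localRepDomain m n φ p) :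
    (chartAt (Euc n) (φ p)).symm (localRep φ p x) = φ ((chartAt (Euc m) p).symm x) :=
  (chartAt (Euc n) (φ p)).left_inv hx.2

variable [IsManifold (𝓡 m) ∞ M] [IsManifold (𝓡 n) ∞ N]

theorem contDiffOn_localRep {φ : M → N} (hφ : ContMDiff (𝓡 m) (𝓡 n) ∞ φ) (p : M) :
    ContDiffOn ℝ ∞ (localRep (m := m) (n := n) φ p) (localRepDomain m n φ p) :=
  (contMDiffOn_chart.comp (hφ.comp_contMDiffOn (contMDiffOn_chart_symm.mono Set.inter_subset_left))
    fun _ hx => hx.2).contDiffOn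

variable {g : Riem m M} {h : Riem n N} {φ : M → N} {κ : M → Sph m} {ι : N → Sph n} {r ρ : ℝ}
  {hr : 0 < r} {hρ : 0 < ρ}

theorem isProperBiharmonicOn_of_sphereIncl_eq {A : Euc (m + 1) →ₗᵢ[ℝ] Euc (n + 1)}
    {b : Euc (n + 1)} (hκ : IsIsometricImmersion g (sphereMetric m r hr) κ)
    (hι : IsIsometricImmersion h (sphereMetric n ρ hρ) ι) (hφ : ContMDiff (𝓡 m) (𝓡 n) ∞ φ)
    (hA : ∀ v, inner ℝ (A v) b = 0)
    (hf : ∀ p, sphereIncl ρ (ι (φ p)) = A (sphereIncl r (κ p)) + b)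
    (hm : m ≠ 0) (hb : b ≠ 0) (hρr : ρ ^ 2 = 2 * r ^ 2) {U : Set M} (hU : U.Nonempty) :
    IsProperBiharmonicOn g h φ U := by
  have hE (p : M) := (isSphericalParam_comp_chart_symm hκ p).mono
    (isOpen_localRepDomain (n := n) hφ.continuous p) Set.inter_subset_left
  have hf_local (p : M) : ∀ x ∈ localRepDomain m n φ p,
      sphereIncl ρ (ι ((chartAt (Euc n) (φ p)).symm (localRep φ p x))) =
        A (sphereIncl r (κ ((chartAt (Euc m) p).symm x))) + b := fun x hx => by
    rw [chartAt_symm_localRep hx, hf]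
  refine ⟨⟨hφ.contMDiffOn, fun p _ => ?_⟩, fun hharm => ?_⟩
  · exact bitensionCoord_eq_zero (hE p)
      (isSphericalParam_comp_chart_symm hι (φ p)) (contDiffOn_localRep hφ p) (mapsTo_localRep φ p)
      hA (hf_local p) hρr (chartAt_mem_localRepDomain φ p)
  · obtain ⟨p, hp⟩ := hU
    exact tensionCoord_ne_zero (hE p)
      (isSphericalParam_comp_chart_symm hι (φ p)) (contDiffOn_localRep hφ p) (mapsTo_localRep φ p)
      hA (hf_local p) hm hb (chartAt_mem_localRepDomain φ p) (hharm.2 p hp)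

end LocalRepresentation

section Stereographic

variable {n : ℕ}

/-- The inclusion `x ↦ (x, 0)` of `ℝⁿ` in `ℝⁿ⁺¹` as the equatorial hyperplane. -/
def equatorialIncl (n : ℕ) : Euc n →ₗᵢ[ℝ] Euc (n + 1) where
  toFun x := WithLp.toLp 2 (Fin.snoc (α := fun _ => ℝ) x 0)
  map_add' x y := by
    ext i
    refine Fin.lastCases ?_ (fun j => ?_) i <;> simp
  map_smul' r x := by
    ext i
    refine Fin.lastCases ?_ (fun j => ?_) i <;> simp
  norm_map' x := by simp [EuclideanSpace.norm_eq, Fin.sum_univ_castSucc]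

theorem equatorialIncl_apply_castSucc (x : Euc n) (i : Fin n) :
    equatorialIncl n x i.castSucc = x i := by
  simp [equatorialIncl]

theorem equatorialIncl_apply_last (x : Euc n) : equatorialIncl n x (Fin.last n) = 0 := by
  simp [equatorialIncl]

theorem inner_equatorialIncl_northPole (x : Euc n) :
    inner ℝ (equatorialIncl n x) (northPole n : Euc (n + 1)) = 0 := by
  simp [equatorialIncl, northPole, EuclideanSpace.inner_single_right]

theorem coe_stereoInv (x : Euc n) : (stereoInv n x : Euc (n + 1)) =
    (2 / (1 + ‖x‖ ^ 2)) • (equatorialIncl n x - northPole n) + northPole n := by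
  ext i
  refine Fin.lastCases ?_ (fun j => ?_) i
  · simp [stereoInv, equatorialIncl, northPole]
    field_simp
    ring
  · simp [stereoInv, equatorialIncl, northPole]
    ring

theorem dist_equatorialIncl_northPole_sq (x : Euc n) :
    dist (equatorialIncl n x) (northPole n) ^ 2 = 1 + ‖x‖ ^ 2 := by
  rw [dist_eq_norm, norm_sub_sq_real, inner_equatorialIncl_northPole, norm_eq_of_mem_sphere,
    LinearIsometry.norm_map]
  ring

theorem equatorialIncl_ne_northPole (x : Euc n) : equatorialIncl n x ≠ northPole n := fun h => by
  have := dist_equatorialIncl_northPole_sq x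
  rw [h, dist_self] at this
  nlinarith [sq_nonneg ‖x‖]

theorem sq_sqrt_two_div_dist (x : Euc n) :
    (√2 / dist (equatorialIncl n x) (northPole n)) ^ 2 = 2 / (1 + ‖x‖ ^ 2) := by
  rw [div_pow, Real.sq_sqrt zero_le_two, dist_equatorialIncl_northPole_sq]

theorem coe_stereoInv_eq_inversion (x : Euc n) : (stereoInv n x : Euc (n + 1)) =
    EuclideanGeometry.inversion (northPole n : Euc (n + 1)) √2 (equatorialIncl n x) := by
  rw [coe_stereoInv, ← sq_sqrt_two_div_dist]
  rfl

theorem stereoInv_injective (n : ℕ) : Function.Injective (stereoInv n) := fun x y h => by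
  have h_coe := congrArg Subtype.val h
  rw [coe_stereoInv_eq_inversion, coe_stereoInv_eq_inversion] at h_coe
  exact (equatorialIncl n).injective
    (EuclideanGeometry.inversion_injective _ (by positivity) h_coe)

theorem mem_range_equatorialIncl {y : Euc (n + 1)} (hy : y (Fin.last n) = 0) :
    y ∈ Set.range (equatorialIncl n) := by
  refine ⟨WithLp.toLp 2 fun i => y i.castSucc, ?_⟩
  ext i
  refine Fin.lastCases ?_ (fun j => ?_) i
  · rw [equatorialIncl_apply_last, hy]
  · rw [equatorialIncl_apply_castSucc]

theorem inversion_apply_last {u : Sph n} (hu : u ≠ northPole n) :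
    EuclideanGeometry.inversion (northPole n : Euc (n + 1)) √2 (u : Euc (n + 1)) (Fin.last n) =
      0 := by
  have hinner : inner ℝ (u : Euc (n + 1)) (northPole n) = (u : Euc (n + 1)) (Fin.last n) := by
    simp [northPole, EuclideanSpace.inner_single_right]
  have hdist : dist (u : Euc (n + 1)) (northPole n) ^ 2 =
      2 * (1 - (u : Euc (n + 1)) (Fin.last n)) := by
    rw [dist_eq_norm, norm_sub_sq_real, norm_eq_of_mem_sphere, norm_eq_of_mem_sphere, hinner]
    ring
  have hne : dist (u : Euc (n + 1)) (northPole n) ≠ 0 :=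
    dist_ne_zero.2 fun h => hu (Subtype.ext h)
  have hnorth : (northPole n : Euc (n + 1)) (Fin.last n) = 1 := by simp [northPole]
  rw [EuclideanGeometry.inversion, div_pow, Real.sq_sqrt zero_le_two]
  simp only [vsub_eq_sub, vadd_eq_add, PiLp.add_apply, PiLp.smul_apply, PiLp.sub_apply, hnorth,
    smul_eq_mul]
  field_simp
  linear_combination hdist

theorem range_stereoInv (n : ℕ) : Set.range (stereoInv n) = {northPole n}ᶜ := by
  ext u
  constructor
  · rintro ⟨x, rfl⟩ h
    have h_coe := congrArg Subtype.val (Set.mem_singleton_iff.1 h)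
    rw [coe_stereoInv_eq_inversion, EuclideanGeometry.inversion_eq_center (by positivity)] at h_coe
    exact equatorialIncl_ne_northPole x h_coe
  · intro hu
    obtain ⟨x, hx⟩ := mem_range_equatorialIncl (inversion_apply_last hu)
    refine ⟨x, Subtype.ext ?_⟩
    rw [coe_stereoInv_eq_inversion, hx, EuclideanGeometry.inversion_inversion _ (by positivity)]

theorem contDiff_coe_stereoInv : ContDiff ℝ ∞ fun x => (stereoInv n x : Euc (n + 1)) := by
  simp only [coe_stereoInv_eq_inversion]
  exact contDiff_const.inversion contDiff_const (equatorialIncl n).contDiff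
    equatorialIncl_ne_northPole

theorem inner_fderiv_coe_stereoInv (x u v : Euc n) :
    inner ℝ (fderiv ℝ (fun y => (stereoInv n y : Euc (n + 1))) x u)
      (fderiv ℝ (fun y => (stereoInv n y : Euc (n + 1))) x v) =
      (2 / (1 + ‖x‖ ^ 2)) ^ 2 * inner ℝ u v := by
  have hderiv := ((EuclideanGeometry.hasFDerivAt_inversion (R := √2)
    (equatorialIncl_ne_northPole x)).comp x
      (equatorialIncl n).toContinuousLinearMap.hasFDerivAt).fderiv
  simp only [coe_stereoInv_eq_inversion]
  rw [sq_sqrt_two_div_dist] at hderiv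
  have happly (w : Euc n) := congrArg (· w) hderiv
  rw [Function.comp_def] at happly
  refine (congrArg₂ (inner ℝ) (happly u) (happly v)).trans ?_
  simp [inner_smul_left, inner_smul_right]
  ring

theorem isIsometricImmersion_stereoInv_smul {c r : ℝ} (hc : 0 < c) (hr : 0 < r)
    (hcr : c * r ^ 2 = 1) :
    IsIsometricImmersion (stereoMetric n c hc) (sphereMetric n r hr)
      fun x => stereoInv n (r • x) := by
  have hsmooth : ContDiff ℝ ∞ (sphereIncl r ∘ fun x => stereoInv n (r • x)) :=
    (contDiff_coe_stereoInv.comp (contDiff_const_smul r)).const_smul r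
  refine (isIsometricImmersion_sphereMetric_iff hr).2
    ⟨(contMDiff_sphere_iff hr.ne').2 hsmooth.contMDiff, fun x => ?_⟩
  have hderiv (w : Euc n) : fderiv ℝ (sphereIncl r ∘ fun y => stereoInv n (r • y)) x w =
      r • r • fderiv ℝ (fun y => (stereoInv n y : Euc (n + 1))) (r • x) w := by
    have hdiff := contDiff_coe_stereoInv (n := n).differentiable (by simp) (r • x)
    have := ((hdiff.hasFDerivAt.comp x ((hasFDerivAt_id x).const_smul r)).const_smul r).fderiv
    refine (congrArg (· w) this).trans ?_
    simp only [FunLike.coe_smul, Pi.smul_apply, ContinuousLinearMap.comp_apply,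
      ContinuousLinearMap.id_apply, map_smul]
  have hform (u v : Euc n) : 4 / (c + ‖x‖ ^ 2) ^ 2 * inner ℝ u v =
      inner ℝ (fderiv ℝ (sphereIncl r ∘ fun y => stereoInv n (r • y)) x u)
        (fderiv ℝ (sphereIncl r ∘ fun y => stereoInv n (r • y)) x v) := by
    have hscale : 1 + (r * ‖x‖) ^ 2 = (c + ‖x‖ ^ 2) * r ^ 2 := by linear_combination -hcr
    simp only [hderiv, inner_smul_left, inner_smul_right, inner_fderiv_coe_stereoInv, norm_smul,
      Real.norm_of_nonneg hr.le, hscale, conj_trivial]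
    field_simp
    ring
  ext u v
  exact (hform u v).trans (pullbackForm_euclidean_apply (m := n) _ x u v).symm

theorem rotateSphere_bijective (T : Euc (n + 1) ≃ₗᵢ[ℝ] Euc (n + 1)) :
    Function.Bijective (rotateSphere T) :=
  ⟨fun _ _ h => Subtype.ext (T.injective (congrArg Subtype.val h)),
    fun u => ⟨rotateSphere T.symm u, Subtype.ext (T.apply_symm_apply _)⟩⟩

theorem isIsometricImmersion_rotateSphere_stereoInv (T : Euc (n + 1) ≃ₗᵢ[ℝ] Euc (n + 1)) :
    IsIsometricImmersion (stereoMetric n 1 one_pos) (sphereMetric n 1 one_pos)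
      fun y => rotateSphere T (stereoInv n y) := by
  refine (isIsometricImmersion_stereoInv_smul one_pos one_pos (by norm_num)).isometry_add one_pos
    (A := T.toLinearIsometry) (b := 0) fun y => ?_
  simp [sphereIncl, rotateSphere]

end Stereographic

section SmallSphere

variable (L : Euc 3 →ₗᵢ[ℝ] Euc 4) (a : Euc 4) (ha : ‖a‖ = 1) (hLa : ∀ v, inner ℝ (L v) a = 0)

theorem sphereIncl_smallSphere (u : Sph 2) : sphereIncl 1 (smallSphere L a ha hLa u) =
    L (sphereIncl (1 / √(2 : ℝ)) u) + (1 / √(2 : ℝ)) • a := by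
  rw [sphereIncl, sphereIncl, one_smul, map_smul, ← smul_add]
  rfl

theorem isIsometricImmersion_smallSphere :
    IsIsometricImmersion (sphereMetric 2 (1 / √(2 : ℝ)) inv_sqrt_two_pos)
      (sphereMetric 3 1 one_pos) (smallSphere L a ha hLa) :=
  isIsometricImmersion_id.isometry_add one_pos (sphereIncl_smallSphere L a ha hLa)

theorem smallSphere_injective : Function.Injective (smallSphere L a ha hLa) := fun u v h => by
  have h_coe : (1 / √(2 : ℝ)) • (L u + a) = (1 / √(2 : ℝ)) • (L v + a) := congrArg Subtype.val h
  exact Subtype.ext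
    (L.injective (add_right_cancel (smul_right_injective _ inv_sqrt_two_pos.ne' h_coe)))

include ha hLa in
theorem range_linearIsometry_eq_orthogonal : LinearMap.range L.toLinearMap = (ℝ ∙ a)ᗮ := by
  refine eq_orthogonal_span_singleton (norm_ne_zero_iff.1 (ha ▸ one_ne_zero)) ?_ ?_
  · rintro _ ⟨v, rfl⟩
    exact hLa v
  · rw [LinearMap.finrank_range_of_inj L.injective]
    simp

theorem range_smallSphere : Set.range (smallSphere L a ha hLa) =
    {X : Sph 3 | inner ℝ (X : Euc 4) a = 1 / √(2 : ℝ)} := by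
  have haa : inner ℝ a a = (1 : ℝ) := by rw [real_inner_self_eq_norm_sq, ha, one_pow]
  ext X
  constructor
  · rintro ⟨u, rfl⟩
    rw [Set.mem_ofPred_eq, smallSphere, inner_smul_left, inner_add_left, hLa, haa]
    simp
  · intro (hX : inner ℝ (X : Euc 4) a = 1 / √(2 : ℝ))
    have horth : √2 • (X : Euc 4) - a ∈ LinearMap.range L.toLinearMap := by
      rw [range_linearIsometry_eq_orthogonal L a ha hLa,
        Submodule.mem_orthogonal_singleton_iff_inner_left, inner_sub_left, inner_smul_left, hX,
        haa]
      simp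
    obtain ⟨v, hv : L v = √2 • (X : Euc 4) - a⟩ := horth
    have hnorm : ‖v‖ ^ 2 = 1 := by
      rw [← L.norm_map, hv, norm_sub_sq_real, inner_smul_left, hX, norm_smul, ha,
        norm_eq_of_mem_sphere, mul_pow, Real.norm_of_nonneg (Real.sqrt_nonneg 2),
        Real.sq_sqrt zero_le_two]
      norm_num
    refine ⟨⟨v, ?_⟩, Subtype.ext ?_⟩
    · rw [mem_sphere_zero_iff_norm, ← sq_eq_sq₀ (norm_nonneg v) zero_le_one, hnorm, one_pow]
    · change (1 / √(2 : ℝ)) • (L v + a) = X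
      rw [hv, sub_add_cancel, smul_smul, one_div_mul_cancel (by positivity), one_smul]

theorem isProperBiharmonicOn_of_comp_eq_smallSphere {M N : Type*}
    [TopologicalSpace M] [ChartedSpace (Euc 2) M] [IsManifold (𝓡 2) ∞ M]
    [TopologicalSpace N] [ChartedSpace (Euc 3) N] [IsManifold (𝓡 3) ∞ N]
    {g : Riem 2 M} {h : Riem 3 N} {φ : M → N} {κ : M → Sph 2} {ι : N → Sph 3}
    (hκ : IsIsometricImmersion g (sphereMetric 2 (1 / √(2 : ℝ)) inv_sqrt_two_pos) κ)
    (hι : IsIsometricImmersion h (sphereMetric 3 1 one_pos) ι) (hφ : ContMDiff (𝓡 2) (𝓡 3) ∞ φ)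
    (hcomp : ∀ p, ι (φ p) = smallSphere L a ha hLa (κ p)) {U : Set M} (hU : U.Nonempty) :
    IsProperBiharmonicOn g h φ U := by
  have hb : (1 / √(2 : ℝ)) • a ≠ 0 :=
    smul_ne_zero inv_sqrt_two_pos.ne' (norm_ne_zero_iff.1 (ha ▸ one_ne_zero))
  refine isProperBiharmonicOn_of_sphereIncl_eq hκ hι hφ
    (fun v => by rw [inner_smul_right, hLa, mul_zero]) (fun p => ?_) two_ne_zero hb
    (by norm_num [div_pow]) hU
  rw [hcomp, sphereIncl_smallSphere]

end SmallSphere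

section Plane

theorem contDiff_planeMap : ContDiff ℝ ∞ planeMap := by
  refine contDiff_euclidean.2 fun i => ?_
  fin_cases i
  · exact (contDiff_euclidean.1 contDiff_id) 0
  · exact (contDiff_euclidean.1 contDiff_id) 1
  · exact contDiff_const

theorem norm_planeMap_sq (x : Euc 2) : ‖planeMap x‖ ^ 2 = ‖x‖ ^ 2 + 1 := by
  simp [planeMap, EuclideanSpace.real_norm_sq_eq, Fin.sum_univ_succ]
  ring

section Orthonormal

variable {E : Type*} [NormedAddCommGroup E] [InnerProductSpace ℝ E]

theorem orthonormal_snoc {k : ℕ} {v : Fin k → E} {a : E} (hv : Orthonormal ℝ v) (ha : ‖a‖ = 1)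
    (hva : ∀ i, inner ℝ (v i) a = 0) : Orthonormal ℝ (Fin.snoc v a : Fin (k + 1) → E) := by
  rw [orthonormal_iff_ite] at hv ⊢
  intro i j
  refine Fin.lastCases ?_ (fun i => ?_) i <;> refine Fin.lastCases ?_ (fun j => ?_) j
  · simp [ha]
  · simp [real_inner_comm (v j), hva, (Fin.castSucc_lt_last j).ne']
  · simp [hva, (Fin.castSucc_lt_last i).ne]
  · simp [hv]

theorem orthonormal_rotate_pi_div_four {v : Fin 4 → E} (hv : Orthonormal ℝ v) : Orthonormal ℝ
    ![v 0, v 1, (1 / √(2 : ℝ)) • (v 3 - v 2), (1 / √(2 : ℝ)) • (v 3 + v 2)] := by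
  have hsq : 1 / √(2 : ℝ) * (1 / √(2 : ℝ)) = 1 / 2 := by
    rw [div_mul_div_comm, Real.mul_self_sqrt zero_le_two, one_mul]
  rw [orthonormal_iff_ite] at hv ⊢
  intro i j
  fin_cases i <;> fin_cases j <;>
    simp [-inner_self_eq_norm_sq_to_K, -one_div, mul_add, hsq, hv, inner_smul_left,
      inner_smul_right, inner_add_left, inner_add_right, inner_sub_left, inner_sub_right,
      add_halves]

end Orthonormal

variable (L : Euc 3 →ₗᵢ[ℝ] Euc 4) (a : Euc 4) (ha : ‖a‖ = 1) (hLa : ∀ v, inner ℝ (L v) a = 0)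

include ha hLa in
theorem exists_rotation_equatorialIncl_planeMap : ∃ T : Euc 4 ≃ₗᵢ[ℝ] Euc 4,
    (∀ x, T (equatorialIncl 3 (planeMap x)) =
      L (equatorialIncl 2 x) + (1 / √(2 : ℝ)) • (a - L (northPole 2))) ∧
    T (northPole 3) = (1 / √(2 : ℝ)) • (a + L (northPole 2)) := by
  let e := EuclideanSpace.basisFun (Fin 3) ℝ
  let w : Fin 4 → Euc 4 :=
    ![L (e 0), L (e 1), (1 / √(2 : ℝ)) • (a - L (e 2)), (1 / √(2 : ℝ)) • (a + L (e 2))]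
  have hw : Orthonormal ℝ w := orthonormal_rotate_pi_div_four
    (orthonormal_snoc (e.orthonormal.comp_linearIsometry L) ha fun i => hLa (e i))
  let B : OrthonormalBasis (Fin 4) ℝ (Euc 4) := OrthonormalBasis.mk hw
    (hw.linearIndependent.span_eq_top_of_card_eq_finrank' (by simp)).ge
  have hB (y : Euc 4) : B.repr.symm y = ∑ i, y i • w i := by
    simp only [← B.sum_repr_symm, B, OrthonormalBasis.coe_mk]
  have hcoord (x : Euc 2) (i : Fin 3) :
      equatorialIncl 3 (planeMap x) i.castSucc = planeMap x i := equatorialIncl_apply_castSucc _ i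
  have hplane (x : Euc 2) : equatorialIncl 2 x = x 0 • e 0 + x 1 • e 1 := by
    ext i
    fin_cases i <;> simp [equatorialIncl, e, Fin.snoc]
  have hpole : (northPole 2 : Euc 3) = e 2 := (EuclideanSpace.basisFun_apply _ _ _).symm
  refine ⟨B.repr.symm, fun x => ?_, ?_⟩
  · rw [hB, Fin.sum_univ_castSucc, Fin.sum_univ_three, hcoord, hcoord, hcoord,
      equatorialIncl_apply_last, hplane, hpole]
    simp [w, planeMap]
  · rw [hpole]
    exact (B.repr_symm_single 3).trans (congrFun (OrthonormalBasis.coe_mk _ _) 3)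

theorem exists_smallSphere_stereoInv_eq : ∃ T : Euc 4 ≃ₗᵢ[ℝ] Euc 4, ∀ x : Euc 2,
    smallSphere L a ha hLa (stereoInv 2 ((1 / √(2 : ℝ)) • x)) =
      rotateSphere T (stereoInv 3 (planeMap x)) := by
  obtain ⟨T, hTplane, hTpole⟩ := exists_rotation_equatorialIncl_planeMap L a ha hLa
  refine ⟨T, fun x => Subtype.ext ?_⟩
  have hnorm : ‖(1 / √(2 : ℝ)) • x‖ ^ 2 = ‖x‖ ^ 2 / 2 := by
    rw [norm_smul, mul_pow, Real.norm_of_nonneg inv_sqrt_two_pos.le, div_pow,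
      Real.sq_sqrt zero_le_two]
    ring
  change (1 / √(2 : ℝ)) • (L (stereoInv 2 ((1 / √(2 : ℝ)) • x) : Euc 3) + a) =
    T (stereoInv 3 (planeMap x) : Euc 4)
  have hden : 1 + ‖x‖ ^ 2 / 2 = (2 + ‖x‖ ^ 2) / 2 := by ring
  have hden' : 1 + (‖x‖ ^ 2 + 1) = 2 + ‖x‖ ^ 2 := by ring
  simp only [coe_stereoInv, hnorm, norm_planeMap_sq, map_add, map_sub, map_smul, hTplane, hTpole,
    hden, hden']
  match_scalars
  · field_simp
    exact (Real.sq_sqrt zero_le_two).symm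
  · field_simp
    ring
  · field_simp
    ring

end Plane

end

theorem mainTheorem7 (L : Euc 3 →ₗᵢ[ℝ] Euc 4) (a : Euc 4) (ha : ‖a‖ = 1)
    (hLa : ∀ v, inner ℝ (L v) a = 0) :
    -- `φ` is an isometric embedding of `S²(1/√2)` onto the small sphere `⟪X, a⟫ = 1/√2` of `S³`
    (IsIsometricImmersion (sphereMetric 2 (1 / √(2 : ℝ)) inv_sqrt_two_pos)
        (sphereMetric 3 1 one_pos) (smallSphere L a ha hLa) ∧
      Function.Injective (smallSphere L a ha hLa) ∧
      Set.range (smallSphere L a ha hLa) =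
        {X : Sph 3 | inner ℝ (X : Euc 4) a = 1 / √(2 : ℝ)}) ∧
    -- the whole sphere and each of its nonempty open parts is proper biharmonic
    (∀ U : Set (Sph 2), IsOpen U → U.Nonempty →
      IsProperBiharmonicOn (sphereMetric 2 (1 / √(2 : ℝ)) inv_sqrt_two_pos)
        (sphereMetric 3 1 one_pos) (smallSphere L a ha hLa) U) ∧
    -- in stereographic coordinates of the two spheres, `φ` is `(x, y) ↦ (x, y, 1)`
    (∃ T : Euc 4 ≃ₗᵢ[ℝ] Euc 4,
      (IsIsometricImmersion (stereoMetric 2 2 two_pos)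
          (sphereMetric 2 (1 / √(2 : ℝ)) inv_sqrt_two_pos)
          (fun x => stereoInv 2 ((1 / √(2 : ℝ)) • x)) ∧
        Function.Injective (fun x => stereoInv 2 ((1 / √(2 : ℝ)) • x)) ∧
        Set.range (fun x => stereoInv 2 ((1 / √(2 : ℝ)) • x)) = {northPole 2}ᶜ) ∧
      (IsIsometricImmersion (stereoMetric 3 1 one_pos) (sphereMetric 3 1 one_pos)
          (fun y => rotateSphere T (stereoInv 3 y)) ∧
        Function.Injective (fun y => rotateSphere T (stereoInv 3 y)) ∧
        Set.range (fun y => rotateSphere T (stereoInv 3 y)) =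
          {rotateSphere T (northPole 3)}ᶜ) ∧
      ∀ x : Euc 2, smallSphere L a ha hLa (stereoInv 2 ((1 / √(2 : ℝ)) • x)) =
        rotateSphere T (stereoInv 3 (planeMap x))) ∧
    -- the coordinate map is an isometric immersion and proper biharmonic
    IsIsometricImmersion (stereoMetric 2 2 two_pos) (stereoMetric 3 1 one_pos) planeMap ∧
    ∀ U : Set (Euc 2), IsOpen U → U.Nonempty →
      IsProperBiharmonicOn (stereoMetric 2 2 two_pos) (stereoMetric 3 1 one_pos) planeMap U := by
  have hφ := isIsometricImmersion_smallSphere L a ha hLa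
  have hP := isIsometricImmersion_stereoInv_smul (n := 2) two_pos inv_sqrt_two_pos (by norm_num)
  obtain ⟨T, hT⟩ := exists_smallSphere_stereoInv_eq L a ha hLa
  have hQ := isIsometricImmersion_rotateSphere_stereoInv T
  have hψ := (hφ.comp hP).of_eq_comp hQ contDiff_planeMap.contMDiff hT
  refine ⟨⟨hφ, smallSphere_injective L a ha hLa, range_smallSphere L a ha hLa⟩, fun U _ hU => ?_,
    ⟨T, ⟨hP, ?_, ?_⟩, ⟨hQ, ?_, ?_⟩, hT⟩, hψ, fun U _ hU => ?_⟩
  · exact isProperBiharmonicOn_of_comp_eq_smallSphere L a ha hLa isIsometricImmersion_id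
      isIsometricImmersion_id hφ.1 (fun _ => rfl) hU
  · exact (stereoInv_injective 2).comp (smul_right_injective _ inv_sqrt_two_pos.ne')
  · exact ((MulAction.surjective₀ inv_sqrt_two_pos.ne').range_comp (stereoInv 2)).trans
      (range_stereoInv 2)
  · exact (rotateSphere_bijective T).1.comp (stereoInv_injective 3)
  · refine (Set.range_comp (rotateSphere T) (stereoInv 3)).trans ?_
    rw [range_stereoInv, Set.image_compl_eq (rotateSphere_bijective T), Set.image_singleton]
  · exact isProperBiharmonicOn_of_comp_eq_smallSphere L a ha hLa hP hQ hψ.1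
      (fun x => (hT x).symm) hU
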